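/- Let $n\ge 1$ and $k>n$ be integers. Let $\mathbb H^n=\mathbb R^n\times\mathbb R^n\times\mathbb R$, with points $(x,y,t)$ and $z=x+iy\in\mathbb C^n$, be the Heisenberg group with group law $$(z,t)*(z',t')=\Big(z+z',\,t+t'+2\,\mathrm{Im}\sum_{j=1}^n z_j\overline{z_j'}\Big).$$ The Korányi metric is $d_K(p,q)=\|q^{-1}*p\|_K$, where $\|(z,t)\|_K=(|z|^4+t^2)^{1/4}$. The Carnot–Carathéodory metric $d_{cc}(p,q)$ is the infimum of $\int_a^b\big(\sum_{j=1}^n(u_j^2+v_j^2)\big)^{1/2}ds$ over all horizontal curves $\gamma:[a,b]\to\mathbb R^{2n+1}$ from $p$ to $q$, that is, absolutely continuous curves with $\gamma'=\sum_{j=1}^n\big(u_jX_j(\gamma)+v_jY_j(\gamma)\big)$ almost everywhere for some measurable $u_j,v_j$, where $X_j=\partial_{x_j}+2y_j\partial_t$ and $Y_j=\partial_{y_j}-2x_j\partial_t$. Let $d$ be either of the metrics $d_{cc}$, $d_K$. Then for every Lebesgue measurable set $E\subset\mathbb R^k$ and every Lipschitz map $f:E\to(\mathbb H^n,d)$ we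 have $\mathcal H^k_d(f(E))=0$, where $\mathcal H^k_d$ is the $k$-dimensional Hausdorff measure with respect to $d$. In other words, $(\mathbb H^n,d)$ is purely $k$-unrectifiable. -/

import Mathlib

open MeasureTheory Set Filter Topology
open scoped NNReal ENNReal

/-- A metric space `X` is purely `k`-unrectifiable if `ℋ^k (f(E)) = 0` for every (Lebesgue)
measurable `E ⊆ ℝ^k` and every map `f` from `E` to `X` that is Lipschitz on `E`
(values of `f` outside `E` are irrelevant). -/
def PurelyUnrectifiable (k : ℕ) (X : Type*) [EMetricSpace X] [MeasurableSpace X]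
    [BorelSpace X] : Prop :=
  ∀ (E : Set (EuclideanSpace ℝ (Fin k))) (f : EuclideanSpace ℝ (Fin k) → X),
    NullMeasurableSet E volume → (∃ L : ℝ≥0, LipschitzOnWith L f E) →
      Measure.hausdorffMeasure (k : ℝ) (f '' E) = 0

/-- The Heisenberg group `ℍ^n`: points `(x, y, t)` of `ℝ^n × ℝ^n × ℝ = ℝ^{2n+1}`, where
`z = x + i y ∈ ℂ^n`. -/
@[ext]
structure Heisenberg (n : ℕ) where
  x : Fin n → ℝ
  y : Fin n → ℝ
  t : ℝ

namespace Heisenberg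

variable {n : ℕ}

/-- The group law `(z, t) * (z', t') = (z + z', t + t' + 2 Im ∑ z_j * conj z'_j)`. -/
instance : Mul (Heisenberg n) :=
  ⟨fun p q => ⟨p.x + q.x, p.y + q.y,
    p.t + q.t + 2 * ∑ i, (p.y i * q.x i - p.x i * q.y i)⟩⟩

instance : One (Heisenberg n) := ⟨⟨0, 0, 0⟩⟩

instance : Inv (Heisenberg n) := ⟨fun p => ⟨-p.x, -p.y, -p.t⟩⟩

@[simp] theorem mul_x (p q : Heisenberg n) : (p * q).x = p.x + q.x := rfl
@[simp] theorem mul_y (p q : Heisenberg n) : (p * q).y = p.y + q.y := rfl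
@[simp] theorem mul_t (p q : Heisenberg n) :
    (p * q).t = p.t + q.t + 2 * ∑ i, (p.y i * q.x i - p.x i * q.y i) := rfl
@[simp] theorem one_x : (1 : Heisenberg n).x = 0 := rfl
@[simp] theorem one_y : (1 : Heisenberg n).y = 0 := rfl
@[simp] theorem one_t : (1 : Heisenberg n).t = 0 := rfl
@[simp] theorem inv_x (p : Heisenberg n) : p⁻¹.x = -p.x := rfl
@[simp] theorem inv_y (p : Heisenberg n) : p⁻¹.y = -p.y := rfl
@[simp] theorem inv_t (p : Heisenberg n) : p⁻¹.t = -p.t := rfl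

instance : Group (Heisenberg n) :=
  Group.ofLeftAxioms
    (by
      intro p q r
      ext i
      · simp [add_assoc]
      · simp [add_assoc]
      · simp only [mul_t, mul_x, mul_y, Pi.add_apply]
        have : ∑ i, ((p.y i + q.y i) * r.x i - (p.x i + q.x i) * r.y i)
              + ∑ i, (p.y i * q.x i - p.x i * q.y i)
            = ∑ i, (p.y i * (q.x i + r.x i) - p.x i * (q.y i + r.y i))
              + ∑ i, (q.y i * r.x i - q.x i * r.y i) := by
          rw [← Finset.sum_add_distrib, ← Finset.sum_add_distrib]
          exact Finset.sum_congr rfl fun i _ => by ring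
        linarith)
    (by intro p; ext i <;> simp)
    (by
      intro p
      ext i
      · simp
      · simp
      · have : ∑ i, (p⁻¹.y i * p.x i - p⁻¹.x i * p.y i) = 0 :=
          Finset.sum_eq_zero fun i _ => by simp; ring
        simp only [mul_t, this, inv_t, one_t]
        ring)

/-- The Korányi gauge `‖(z, t)‖ = (|z|^4 + t^2)^{1/4}`. -/
noncomputable def koranyiNorm (p : Heisenberg n) : ℝ :=
  ((∑ i, (p.x i ^ 2 + p.y i ^ 2)) ^ 2 + p.t ^ 2) ^ (1 / 4 : ℝ)

/-- The Korányi distance `d_K(p, q) = ‖q⁻¹ * p‖`. -/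
noncomputable def koranyiDist (p q : Heisenberg n) : ℝ := koranyiNorm (q⁻¹ * p)

theorem koranyiNorm_eq (p : Heisenberg n) :
    koranyiNorm p = √‖(⟨∑ i, (p.x i ^ 2 + p.y i ^ 2), p.t⟩ : ℂ)‖ := by
  rw [koranyiNorm, Complex.norm_def, Complex.normSq_mk, Real.sqrt_eq_rpow, Real.sqrt_eq_rpow,
    ← Real.rpow_mul (add_nonneg (mul_self_nonneg _) (mul_self_nonneg _))]
  norm_num [sq]

theorem koranyiNorm_one : koranyiNorm (1 : Heisenberg n) = 0 := by
  simp [koranyiNorm]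

theorem koranyiNorm_inv (p : Heisenberg n) : koranyiNorm p⁻¹ = koranyiNorm p := by
  simp [koranyiNorm]

theorem eq_one_of_koranyiNorm_eq_zero {p : Heisenberg n} (h : koranyiNorm p = 0) : p = 1 := by
  rw [koranyiNorm_eq, Real.sqrt_eq_zero (norm_nonneg _), norm_eq_zero, Complex.ext_iff] at h
  obtain ⟨h1, h2⟩ := h
  simp only [Complex.zero_re, Complex.zero_im] at h1 h2
  rw [Finset.sum_eq_zero_iff_of_nonneg (fun i _ => by positivity)] at h1
  ext i
  · have := h1 i (Finset.mem_univ _)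
    simp only [one_x, Pi.zero_apply]
    nlinarith [sq_nonneg (p.x i), sq_nonneg (p.y i)]
  · have := h1 i (Finset.mem_univ _)
    simp only [one_y, Pi.zero_apply]
    nlinarith [sq_nonneg (p.x i), sq_nonneg (p.y i)]
  · simpa using h2

theorem koranyiNorm_mul_le (p q : Heisenberg n) :
    koranyiNorm (p * q) ≤ koranyiNorm p + koranyiNorm q := by
  have key : ∀ r : Heisenberg n, 0 ≤ koranyiNorm r ∧
      koranyiNorm r ^ 2 = ‖(⟨∑ i, (r.x i ^ 2 + r.y i ^ 2), r.t⟩ : ℂ)‖ := fun r => by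
    rw [koranyiNorm_eq]
    exact ⟨Real.sqrt_nonneg _, Real.sq_sqrt (norm_nonneg _)⟩
  let z : Heisenberg n → EuclideanSpace ℂ (Fin n) := fun r => WithLp.toLp 2 fun i => ⟨r.x i, r.y i⟩
  have hz : ∀ r : Heisenberg n, ‖z r‖ ≤ koranyiNorm r := fun r => by
    refine le_of_sq_le_sq ?_ (key r).1
    rw [(key r).2, EuclideanSpace.norm_sq_eq]
    refine le_trans (le_of_eq ?_) (Complex.re_le_norm _)
    simp only [z]
    refine Finset.sum_congr rfl fun i _ => ?_
    rw [Complex.sq_norm, Complex.normSq_mk]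
    ring
  have hsplit : (⟨∑ i, ((p * q).x i ^ 2 + (p * q).y i ^ 2), (p * q).t⟩ : ℂ)
      = ⟨∑ i, (p.x i ^ 2 + p.y i ^ 2), p.t⟩ + ⟨∑ i, (q.x i ^ 2 + q.y i ^ 2), q.t⟩
        + 2 * inner ℂ (z q) (z p) := by
    have hin : inner ℂ (z q) (z p) = (⟨∑ i, (p.x i * q.x i + p.y i * q.y i),
        ∑ i, (p.y i * q.x i - p.x i * q.y i)⟩ : ℂ) := by
      rw [PiLp.inner_apply]
      apply Complex.ext
      · rw [Complex.re_sum]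
        refine Finset.sum_congr rfl fun i _ => ?_
        simp [z]
      · rw [Complex.im_sum]
        refine Finset.sum_congr rfl fun i _ => ?_
        simp [z]
        ring
    rw [hin]
    apply Complex.ext
    · simp only [mul_x, mul_y, Pi.add_apply, Complex.add_re, Complex.mul_re, Complex.re_ofNat,
        Complex.im_ofNat, zero_mul, sub_zero]
      rw [Finset.mul_sum, ← Finset.sum_add_distrib, ← Finset.sum_add_distrib]
      exact Finset.sum_congr rfl fun i _ => by ring
    · simp
  refine le_of_sq_le_sq ?_ (add_nonneg (key p).1 (key q).1)
  rw [(key (p * q)).2, hsplit]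
  refine (norm_add_le _ _).trans ((add_le_add_left (norm_add_le _ _) _).trans ?_)
  rw [← (key p).2, ← (key q).2, norm_mul]
  have h1 : ‖inner ℂ (z q) (z p)‖ ≤ koranyiNorm q * koranyiNorm p :=
    (norm_inner_le_norm _ _).trans
      (mul_le_mul (hz q) (hz p) (norm_nonneg _) (key q).1)
  have h2 : ‖(2 : ℂ)‖ = 2 := by simp
  rw [h2]
  nlinarith

/-! ### Horizontal curves and the Carnot–Carathéodory distance -/

/-- `γ` is an absolutely continuous curve on `[a, b]` (as a curve in `ℝ^{2n+1}`) with
`γ'(s) = ∑ i, (u_i(s) X_i(γ(s)) + v_i(s) Y_i(γ(s)))` for almost every `s ∈ [a, b]`, where `u_i`,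
`v_i` are measurable and `X_i = ∂/∂x_i + 2 y_i ∂/∂t`, `Y_i = ∂/∂y_i - 2 x_i ∂/∂t` are the
left-invariant horizontal vector fields. -/
structure IsHorizontalCurve (γ : ℝ → Heisenberg n) (u v : ℝ → Fin n → ℝ) (a b : ℝ) : Prop where
  le : a ≤ b
  ac_x : ∀ i, AbsolutelyContinuousOnInterval (fun s => (γ s).x i) a b
  ac_y : ∀ i, AbsolutelyContinuousOnInterval (fun s => (γ s).y i) a b
  ac_t : AbsolutelyContinuousOnInterval (fun s => (γ s).t) a b
  measurable_u : Measurable u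
  measurable_v : Measurable v
  deriv_x : ∀ᵐ s, s ∈ Icc a b → ∀ i, HasDerivAt (fun r => (γ r).x i) (u s i) s
  deriv_y : ∀ᵐ s, s ∈ Icc a b → ∀ i, HasDerivAt (fun r => (γ r).y i) (v s i) s
  deriv_t : ∀ᵐ s, s ∈ Icc a b → HasDerivAt (fun r => (γ r).t)
    (∑ i, (u s i * (2 * (γ s).y i) + v s i * (-(2 * (γ s).x i)))) s

/-- The horizontal length `∫_a^b (∑ i, (u_i^2 + v_i^2))^{1/2} ds` of a horizontal curve with
coefficients `u`, `v`. -/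
noncomputable def horizontalLength (u v : ℝ → Fin n → ℝ) (a b : ℝ) : ℝ≥0∞ :=
  ∫⁻ s in Icc a b, ENNReal.ofReal √(∑ i, (u s i ^ 2 + v s i ^ 2))

/-- The Carnot–Carathéodory distance: the infimum of the horizontal lengths of all horizontal
curves from `p` to `q`. For `n ≥ 1` it is finite, see `ccDist_ne_top`. -/
noncomputable def ccDist (p q : Heisenberg n) : ℝ≥0∞ :=
  sInf {ℓ | ∃ (γ : ℝ → Heisenberg n) (u v : ℝ → Fin n → ℝ) (a b : ℝ),
    IsHorizontalCurve γ u v a b ∧ γ a = p ∧ γ b = q ∧ horizontalLength u v a b = ℓ}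

theorem ac_congr {f g : ℝ → ℝ} {a b : ℝ} (hf : AbsolutelyContinuousOnInterval f a b)
    (h : ∀ s ∈ uIcc a b, f s = g s) : AbsolutelyContinuousOnInterval g a b := by
  rw [absolutelyContinuousOnInterval_iff] at hf ⊢
  intro ε hε
  obtain ⟨δ, hδ, H⟩ := hf ε hε
  refine ⟨δ, hδ, fun E hE hlt => ?_⟩
  convert H E hE hlt using 1
  refine Finset.sum_congr rfl fun i hi => ?_
  rw [h _ (hE.1 i hi).1, h _ (hE.1 i hi).2]

theorem ac_of_integral {f g : ℝ → ℝ} {a b c : ℝ} (hg : IntervalIntegrable g volume a b)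
    (h : ∀ s ∈ uIcc a b, f s = c + ∫ r in a..s, g r) : AbsolutelyContinuousOnInterval f a b := by
  have h1 := hg.absolutelyContinuousOnInterval_intervalIntegral (c := a) (by simp)
  have h2 : AbsolutelyContinuousOnInterval (fun _ : ℝ => c) a b :=
    (LipschitzWith.const c).lipschitzOnWith.absolutelyContinuousOnInterval
  exact ac_congr (h2.add h1) fun s hs => by rw [h s hs]; rfl

theorem eq_add_integral_of_ac {f : ℝ → ℝ} {a b : ℝ} (hf : AbsolutelyContinuousOnInterval f a b)
    {s : ℝ} (hs : s ∈ uIcc a b) : f s = f a + ∫ r in a..s, deriv f r := by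
  rw [(hf.mono (uIcc_subset_uIcc_left hs)).integral_deriv_eq_sub]
  ring

theorem ac_reflect {f : ℝ → ℝ} {a b : ℝ} (hf : AbsolutelyContinuousOnInterval f a b) (c : ℝ) :
    AbsolutelyContinuousOnInterval (fun s => f (c - s)) (c - a) (c - b) := by
  have hi := hf.intervalIntegrable_deriv
  refine ac_of_integral (g := fun s => -deriv f (c - s)) (c := f a) (hi.comp_sub_left c).neg ?_
  intro s hs
  have hs' : c - s ∈ uIcc a b := by
    rw [← sub_sub_cancel c a, ← sub_sub_cancel c b, ← Set.image_const_sub_uIcc]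
    exact ⟨s, hs, rfl⟩
  rw [eq_add_integral_of_ac hf hs', intervalIntegral.integral_neg,
    intervalIntegral.integral_comp_sub_left (fun r => deriv f r), sub_sub_cancel,
    intervalIntegral.integral_symm a, neg_neg]

theorem ac_concat {f g : ℝ → ℝ} {a b c : ℝ} (hab : a ≤ b) (hbc : b ≤ c)
    (hf : AbsolutelyContinuousOnInterval f a b) (hg : AbsolutelyContinuousOnInterval g b c)
    (h : f b = g b) :
    AbsolutelyContinuousOnInterval (fun s => if s ≤ b then f s else g s) a c := by
  set G : ℝ → ℝ := fun s => if s ≤ b then deriv f s else deriv g s with hG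
  have i1 : IntervalIntegrable G volume a b :=
    hf.intervalIntegrable_deriv.congr fun r hr => by
      rw [uIoc_of_le hab] at hr
      simp [hG, hr.2]
  have i2 : IntervalIntegrable G volume b c :=
    hg.intervalIntegrable_deriv.congr fun r hr => by
      rw [uIoc_of_le hbc] at hr
      simp [hG, not_le.2 hr.1]
  refine ac_of_integral (g := G) (c := f a) (i1.trans i2) ?_
  intro s hs
  rw [uIcc_of_le (hab.trans hbc)] at hs
  by_cases hsb : s ≤ b
  · have hs' : s ∈ uIcc a b := by rw [uIcc_of_le hab]; exact ⟨hs.1, hsb⟩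
    simp only [hsb, if_true]
    rw [eq_add_integral_of_ac hf hs']
    congr 1
    refine intervalIntegral.integral_congr_ae (ae_of_all _ fun r hr => ?_)
    rw [uIoc_of_le hs.1] at hr
    simp [hG, hr.2.trans hsb]
  · have hbs : b ≤ s := (not_le.1 hsb).le
    have hs' : s ∈ uIcc b c := by rw [uIcc_of_le hbc]; exact ⟨hbs, hs.2⟩
    simp only [hsb, if_false]
    rw [← intervalIntegral.integral_add_adjacent_intervals i1
        (i2.mono_set (uIcc_subset_uIcc_left hs')), eq_add_integral_of_ac hg hs', ← h,
      eq_add_integral_of_ac hf (right_mem_uIcc : b ∈ uIcc a b), add_assoc]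
    congr 2
    · refine intervalIntegral.integral_congr_ae (ae_of_all _ fun r hr => ?_)
      rw [uIoc_of_le hab] at hr
      simp [hG, hr.2]
    · refine intervalIntegral.integral_congr_ae (ae_of_all _ fun r hr => ?_)
      rw [uIoc_of_le hbs] at hr
      simp [hG, not_le.2 hr.1]

theorem ae_reflect {P : ℝ → Prop} (h : ∀ᵐ s, P s) (c : ℝ) : ∀ᵐ s : ℝ, P (c - s) :=
  (Measure.measurePreserving_sub_left volume c).quasiMeasurePreserving.ae h

theorem IsHorizontalCurve.reflect {γ : ℝ → Heisenberg n} {u v : ℝ → Fin n → ℝ} {a b : ℝ}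
    (h : IsHorizontalCurve γ u v a b) (c : ℝ) :
    IsHorizontalCurve (fun s => γ (c - s)) (fun s => -u (c - s)) (fun s => -v (c - s))
      (c - b) (c - a) where
  le := by linarith [h.le]
  ac_x i := (ac_reflect (h.ac_x i) c).symm
  ac_y i := (ac_reflect (h.ac_y i) c).symm
  ac_t := (ac_reflect h.ac_t c).symm
  measurable_u := (h.measurable_u.comp (measurable_const.sub measurable_id)).neg
  measurable_v := (h.measurable_v.comp (measurable_const.sub measurable_id)).neg
  deriv_x := by
    filter_upwards [ae_reflect h.deriv_x c] with s hs hm i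
    have := HasDerivAt.comp_const_sub c s (hs ⟨by linarith [hm.2], by linarith [hm.1]⟩ i)
    exact this
  deriv_y := by
    filter_upwards [ae_reflect h.deriv_y c] with s hs hm i
    have := HasDerivAt.comp_const_sub c s (hs ⟨by linarith [hm.2], by linarith [hm.1]⟩ i)
    exact this
  deriv_t := by
    filter_upwards [ae_reflect h.deriv_t c] with s hs hm
    have := HasDerivAt.comp_const_sub c s (hs ⟨by linarith [hm.2], by linarith [hm.1]⟩)
    refine HasDerivAt.congr_deriv this ?_
    rw [← Finset.sum_neg_distrib]
    refine Finset.sum_congr rfl fun i _ => ?_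
    simp only [Pi.neg_apply]
    ring

theorem horizontalLength_reflect (u v : ℝ → Fin n → ℝ) (a b c : ℝ) :
    horizontalLength (fun s => -u (c - s)) (fun s => -v (c - s)) (c - b) (c - a)
      = horizontalLength u v a b := by
  have h := (Measure.measurePreserving_sub_left (volume : Measure ℝ) c).setLIntegral_comp_preimage_emb
    (MeasurableEquiv.subLeft c).measurableEmbedding
    (fun s => ENNReal.ofReal √(∑ i, (u s i ^ 2 + v s i ^ 2))) (Icc a b)
  rw [Set.preimage_const_sub_Icc] at h
  simpa [horizontalLength] using h

theorem IsHorizontalCurve.concat {γ γ' : ℝ → Heisenberg n} {u v u' v' : ℝ → Fin n → ℝ}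
    {a b c : ℝ} (h : IsHorizontalCurve γ u v a b) (h' : IsHorizontalCurve γ' u' v' b c)
    (hb : γ b = γ' b) :
    IsHorizontalCurve (fun s => if s ≤ b then γ s else γ' s) (fun s => if s ≤ b then u s else u' s)
      (fun s => if s ≤ b then v s else v' s) a c := by
  have hne : ∀ᵐ s : ℝ, s ≠ b := by simp [ae_iff]
  have key : ∀ (φ : Heisenberg n → ℝ) (s d d' : ℝ), s ∈ Icc a c → s ≠ b →
      (s ∈ Icc a b → HasDerivAt (fun r => φ (γ r)) d s) →
      (s ∈ Icc b c → HasDerivAt (fun r => φ (γ' r)) d' s) →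
      HasDerivAt (fun r => φ (if r ≤ b then γ r else γ' r)) (if s ≤ b then d else d') s := by
    intro φ s d d' hs hsb h1 h2
    rcases lt_or_gt_of_ne hsb with hlt | hgt
    · rw [if_pos hlt.le]
      refine (h1 ⟨hs.1, hlt.le⟩).congr_of_eventuallyEq ?_
      filter_upwards [eventually_lt_nhds hlt] with r hr
      rw [if_pos hr.le]
    · rw [if_neg (not_le.2 hgt)]
      refine (h2 ⟨hgt.le, hs.2⟩).congr_of_eventuallyEq ?_
      filter_upwards [eventually_gt_nhds hgt] with r hr
      rw [if_neg (not_le.2 hr)]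
  have hac : ∀ φ : Heisenberg n → ℝ,
      AbsolutelyContinuousOnInterval (fun s => φ (γ s)) a b →
      AbsolutelyContinuousOnInterval (fun s => φ (γ' s)) b c →
      AbsolutelyContinuousOnInterval (fun s => φ (if s ≤ b then γ s else γ' s)) a c := by
    intro φ h1 h2
    have h3 := ac_concat h.le h'.le h1 h2 (by rw [hb])
    refine ac_congr h3 fun s _ => ?_
    split_ifs <;> rfl
  refine ⟨h.le.trans h'.le, fun i => hac (fun p => p.x i) (h.ac_x i) (h'.ac_x i),
    fun i => hac (fun p => p.y i) (h.ac_y i) (h'.ac_y i), hac (fun p => p.t) h.ac_t h'.ac_t,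
    Measurable.ite measurableSet_Iic h.measurable_u h'.measurable_u,
    Measurable.ite measurableSet_Iic h.measurable_v h'.measurable_v, ?_, ?_, ?_⟩
  · filter_upwards [hne, h.deriv_x, h'.deriv_x] with s hs h1 h2 hm i
    convert key (fun p => p.x i) s _ _ hm hs (fun hs => h1 hs i) (fun hs => h2 hs i) using 1
    split_ifs <;> rfl
  · filter_upwards [hne, h.deriv_y, h'.deriv_y] with s hs h1 h2 hm i
    convert key (fun p => p.y i) s _ _ hm hs (fun hs => h1 hs i) (fun hs => h2 hs i) using 1
    split_ifs <;> rfl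
  · filter_upwards [hne, h.deriv_t, h'.deriv_t] with s hs h1 h2 hm
    convert key (fun p => p.t) s _ _ hm hs h1 h2 using 1
    split_ifs <;> rfl

theorem horizontalLength_concat_le (u v u' v' : ℝ → Fin n → ℝ) (a b c : ℝ) :
    horizontalLength (fun s => if s ≤ b then u s else u' s)
      (fun s => if s ≤ b then v s else v' s) a c
      ≤ horizontalLength u v a b + horizontalLength u' v' b c := by
  have hsub : Icc a c ⊆ Icc a b ∪ Ioc b c := fun s hs => by
    rcases le_or_gt s b with h | h
    · exact Or.inl ⟨hs.1, h⟩
    · exact Or.inr ⟨h, hs.2⟩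
  refine (lintegral_mono_set hsub).trans ((lintegral_union_le _ _ _).trans (add_le_add ?_ ?_))
  · refine le_of_eq (setLIntegral_congr_fun measurableSet_Icc fun s hs => ?_)
    simp [hs.2]
  · refine le_trans (le_of_eq (setLIntegral_congr_fun measurableSet_Ioc fun s hs => ?_))
      (lintegral_mono_set Ioc_subset_Icc_self)
    simp [not_le.2 hs.1]

theorem ccDist_le {γ : ℝ → Heisenberg n} {u v : ℝ → Fin n → ℝ} {a b : ℝ}
    (h : IsHorizontalCurve γ u v a b) : ccDist (γ a) (γ b) ≤ horizontalLength u v a b :=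
  sInf_le ⟨γ, u, v, a, b, h, rfl, rfl, rfl⟩

theorem ccDist_comm_le (p q : Heisenberg n) : ccDist q p ≤ ccDist p q := by
  refine le_sInf ?_
  rintro _ ⟨γ, u, v, a, b, h, rfl, rfl, rfl⟩
  have := ccDist_le (h.reflect 0)
  simpa only [horizontalLength_reflect, sub_sub_cancel] using this

theorem ccDist_triangle (p q r : Heisenberg n) : ccDist p r ≤ ccDist p q + ccDist q r := by
  unfold ccDist
  rw [ENNReal.sInf_add]
  refine le_iInf₂ fun ℓ hℓ => ?_
  rw [add_comm, ENNReal.sInf_add]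
  refine le_iInf₂ fun ℓ' hℓ' => ?_
  obtain ⟨γ, u, v, a, b, h, rfl, hq, rfl⟩ := hℓ
  obtain ⟨γ', u', v', a', b', h', hq', rfl, rfl⟩ := hℓ'
  have h2 := (h'.reflect 0).reflect (b - a')
  rw [show b - a' - (0 - a') = b by ring] at h2
  have h3 := h.concat h2 (by simp [hq, hq'])
  have h4 := (ccDist_le h3).trans (horizontalLength_concat_le _ _ _ _ _ _ _)
  have h5 := horizontalLength_reflect (fun s => -u' (0 - s)) (fun s => -v' (0 - s))
    (0 - b') (0 - a') (b - a')
  rw [show b - a' - (0 - a') = b by ring, horizontalLength_reflect] at h5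
  rw [h5, add_comm] at h4
  refine le_trans (le_of_eq ?_) h4
  have hb' : b ≤ b - a' - (0 - b') := by linarith [h'.le]
  rw [← ccDist, if_pos h.le]
  congr 1
  by_cases hb : b - a' - (0 - b') ≤ b
  · have : b' = a' := by linarith [h'.le]
    subst this
    rw [if_pos hb]
    simp [hq, hq']
  · rw [if_neg hb]
    congr 1
    ring

theorem edist_le_of_ac {f g ℓ : ℝ → ℝ} {a b : ℝ} (K : ℝ≥0) (hab : a ≤ b)
    (hf : AbsolutelyContinuousOnInterval f a b)
    (hd : ∀ᵐ s, s ∈ Icc a b → HasDerivAt f (g s) s)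
    (hg : ∀ s ∈ Icc a b, |g s| ≤ K * ℓ s) :
    edist (f b) (f a) ≤ K * ∫⁻ s in Icc a b, ENNReal.ofReal (ℓ s) := by
  rw [edist_eq_enorm_sub, ← hf.integral_deriv_eq_sub, intervalIntegral.integral_of_le hab,
    ← lintegral_const_mul' _ _ ENNReal.coe_ne_top]
  refine (enorm_integral_le_lintegral_enorm _).trans ?_
  refine (lintegral_mono_set Ioc_subset_Icc_self).trans (lintegral_mono_ae ?_)
  rw [ae_restrict_iff' measurableSet_Icc]
  filter_upwards [hd] with s hs hm
  rw [(hs hm).deriv, ← ENNReal.ofReal_coe_nnreal, ← ENNReal.ofReal_mul K.coe_nonneg,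
    Real.enorm_eq_ofReal_abs]
  exact ENNReal.ofReal_le_ofReal (hg s hm)

theorem abs_le_sqrt_sum (u v : Fin n → ℝ) (i : Fin n) :
    |u i| ≤ √(∑ i, (u i ^ 2 + v i ^ 2)) ∧ |v i| ≤ √(∑ i, (u i ^ 2 + v i ^ 2)) := by
  have h := Finset.single_le_sum (f := fun i => u i ^ 2 + v i ^ 2)
    (fun i _ => by positivity) (Finset.mem_univ i)
  constructor
  · exact Real.abs_le_sqrt (le_trans (by nlinarith [sq_nonneg (v i)]) h)
  · exact Real.abs_le_sqrt (le_trans (by nlinarith [sq_nonneg (u i)]) h)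

theorem IsHorizontalCurve.edist_xy_le {γ : ℝ → Heisenberg n} {u v : ℝ → Fin n → ℝ} {a b : ℝ}
    (h : IsHorizontalCurve γ u v a b) {s : ℝ} (hs : s ∈ Icc a b) (i : Fin n) :
    edist ((γ s).x i) ((γ a).x i) ≤ horizontalLength u v a b ∧
      edist ((γ s).y i) ((γ a).y i) ≤ horizontalLength u v a b := by
  have hsub : uIcc a s ⊆ uIcc a b := by
    rw [uIcc_of_le h.le, uIcc_of_le hs.1]
    exact Icc_subset_Icc_right hs.2
  have hmono : ∫⁻ r in Icc a s, ENNReal.ofReal √(∑ i, (u r i ^ 2 + v r i ^ 2))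
      ≤ horizontalLength u v a b := lintegral_mono_set (Icc_subset_Icc_right hs.2)
  constructor
  · refine le_trans ?_ hmono
    have := edist_le_of_ac (g := fun r => u r i)
      (ℓ := fun r => √(∑ i, (u r i ^ 2 + v r i ^ 2))) 1 hs.1 ((h.ac_x i).mono hsub)
      (by filter_upwards [h.deriv_x] with r hr hm using hr ⟨hm.1, hm.2.trans hs.2⟩ i)
      (fun r _ => by simpa using (abs_le_sqrt_sum (u r) (v r) i).1)
    simpa using this
  · refine le_trans ?_ hmono
    have := edist_le_of_ac (g := fun r => v r i)
      (ℓ := fun r => √(∑ i, (u r i ^ 2 + v r i ^ 2))) 1 hs.1 ((h.ac_y i).mono hsub)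
      (by filter_upwards [h.deriv_y] with r hr hm using hr ⟨hm.1, hm.2.trans hs.2⟩ i)
      (fun r _ => by simpa using (abs_le_sqrt_sum (u r) (v r) i).2)
    simpa using this

theorem exists_edist_le_ccDist (p : Heisenberg n) :
    ∃ K : ℝ≥0, ∀ (γ : ℝ → Heisenberg n) (u v : ℝ → Fin n → ℝ) (a b : ℝ),
      IsHorizontalCurve γ u v a b → γ a = p → horizontalLength u v a b < 1 →
      edist (γ b).t p.t ≤ K * horizontalLength u v a b := by
  let M : ℝ := ∑ i, (|p.x i| + |p.y i|) + 1
  have hM : 0 ≤ M := by positivity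
  refine ⟨⟨∑ _i : Fin n, (4 * M), by positivity⟩, ?_⟩
  rintro γ u v a b h rfl hlt
  have hbd : ∀ s ∈ Icc a b, ∀ i, |(γ s).x i| ≤ M ∧ |(γ s).y i| ≤ M := by
    intro s hs i
    have h1 := h.edist_xy_le hs i
    have h2 : dist ((γ s).x i) ((γ a).x i) ≤ 1 := by
      have := (h1.1.trans_lt hlt).le
      rwa [edist_dist, ENNReal.ofReal_le_one] at this
    have h3 : dist ((γ s).y i) ((γ a).y i) ≤ 1 := by
      have := (h1.2.trans_lt hlt).le
      rwa [edist_dist, ENNReal.ofReal_le_one] at this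
    rw [Real.dist_eq] at h2 h3
    have h4 : |(γ a).x i| + |(γ a).y i| ≤ ∑ i, (|(γ a).x i| + |(γ a).y i|) :=
      Finset.single_le_sum (f := fun i => |(γ a).x i| + |(γ a).y i|)
        (fun i _ => by positivity) (Finset.mem_univ i)
    have h5 := abs_sub_abs_le_abs_sub ((γ s).x i) ((γ a).x i)
    have h6 := abs_sub_abs_le_abs_sub ((γ s).y i) ((γ a).y i)
    have h7 := abs_nonneg ((γ a).x i)
    have h8 := abs_nonneg ((γ a).y i)
    constructor <;> simp only [M] <;> linarith
  refine edist_le_of_ac (ℓ := fun r => √(∑ i, (u r i ^ 2 + v r i ^ 2))) _ h.le h.ac_t h.deriv_t ?_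
  intro s hs
  refine (Finset.abs_sum_le_sum_abs _ _).trans ?_
  change _ ≤ (∑ _i : Fin n, (4 * M)) * _
  rw [Finset.sum_mul]
  refine Finset.sum_le_sum fun i _ => ?_
  obtain ⟨h1, h2⟩ := abs_le_sqrt_sum (u s) (v s) i
  obtain ⟨h3, h4⟩ := hbd s hs i
  refine (abs_add_le _ _).trans ?_
  simp only [abs_mul, abs_neg, abs_two]
  have h5 := mul_le_mul h1 h4 (abs_nonneg _) (Real.sqrt_nonneg _)
  have h6 := mul_le_mul h2 h3 (abs_nonneg _) (Real.sqrt_nonneg _)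
  nlinarith

theorem eq_of_ccDist_eq_zero {p q : Heisenberg n} (h0 : ccDist p q = 0) : p = q := by
  obtain ⟨K, hK⟩ := exists_edist_le_ccDist p
  have key : ∀ ε : ℝ≥0∞, 0 < ε → ε ≤ 1 → (∀ i, edist (q.x i) (p.x i) ≤ ε) ∧
      (∀ i, edist (q.y i) (p.y i) ≤ ε) ∧ edist q.t p.t ≤ K * ε := by
    intro ε hε hε1
    rw [← h0] at hε
    obtain ⟨_, ⟨γ, u, v, a, b, h, rfl, rfl, rfl⟩, hlt⟩ := sInf_lt_iff.1 hε
    have hb : b ∈ Icc a b := ⟨h.le, le_rfl⟩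
    exact ⟨fun i => (h.edist_xy_le hb i).1.trans hlt.le,
      fun i => (h.edist_xy_le hb i).2.trans hlt.le,
      (hK γ u v a b h rfl (hlt.trans_le hε1)).trans (mul_le_mul_right hlt.le _)⟩
  have lim : ∀ (C : ℝ≥0) (d : ℝ≥0∞), (∀ ε : ℝ≥0∞, 0 < ε → ε ≤ 1 → d ≤ C * ε) → d = 0 := by
    intro C d h
    have h1 : Tendsto (fun ε : ℝ≥0∞ => C * ε) (𝓝[>] 0) (𝓝 (C * 0)) :=
      (ENNReal.Tendsto.const_mul tendsto_id (Or.inr ENNReal.coe_ne_top)).mono_left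
        nhdsWithin_le_nhds
    rw [mul_zero] at h1
    refine le_antisymm (ge_of_tendsto h1 ?_) (zero_le)
    filter_upwards [Ioo_mem_nhdsGT (zero_lt_one (α := ℝ≥0∞))] with ε hε
    exact h ε hε.1 hε.2.le
  ext i
  · exact (edist_eq_zero.1 (lim 1 _ fun ε h h' => by simpa using (key ε h h').1 i)).symm
  · exact (edist_eq_zero.1 (lim 1 _ fun ε h h' => by simpa using (key ε h h').2.1 i)).symm
  · exact (edist_eq_zero.1 (lim K _ fun ε h h' => (key ε h h').2.2)).symm

theorem isHorizontalCurve_line (p : Heisenberg n) (u v : Fin n → ℝ) :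
    IsHorizontalCurve (fun s => p * ⟨s • u, s • v, 0⟩) (fun _ => u) (fun _ => v) 0 1 := by
  have hx : ∀ (i : Fin n) (s : ℝ),
      HasDerivAt (fun r : ℝ => (p * ⟨r • u, r • v, 0⟩ : Heisenberg n).x i) (u i) s := by
    intro i s
    simpa using ((hasDerivAt_id s).mul_const (u i)).const_add (p.x i)
  have hy : ∀ (i : Fin n) (s : ℝ),
      HasDerivAt (fun r : ℝ => (p * ⟨r • u, r • v, 0⟩ : Heisenberg n).y i) (v i) s := by
    intro i s
    simpa using ((hasDerivAt_id s).mul_const (v i)).const_add (p.y i)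
  have heq : ∀ r : ℝ, (p * ⟨r • u, r • v, 0⟩ : Heisenberg n).t
      = p.t + r * (2 * ∑ i, (p.y i * u i - p.x i * v i)) := by
    intro r
    simp only [mul_t, Pi.smul_apply, smul_eq_mul, add_zero, Finset.mul_sum]
    congr 1
    exact Finset.sum_congr rfl fun i _ => by ring
  have ht : ∀ s : ℝ, HasDerivAt (fun r : ℝ => (p * ⟨r • u, r • v, 0⟩ : Heisenberg n).t)
      (2 * ∑ i, (p.y i * u i - p.x i * v i)) s := by
    intro s
    simp only [heq]
    simpa using ((hasDerivAt_id s).mul_const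
      (2 * ∑ i, (p.y i * u i - p.x i * v i))).const_add p.t
  have hac : ∀ (f : ℝ → ℝ) (d : ℝ), (∀ s, HasDerivAt f d s) →
      AbsolutelyContinuousOnInterval f 0 1 := by
    intro f d hf
    have hd : deriv f = fun _ => d := funext fun s => (hf s).deriv
    exact ContDiffOn.absolutelyContinuousOnInterval (contDiff_one_iff_deriv.2
      ⟨fun s => (hf s).differentiableAt, hd ▸ continuous_const⟩).contDiffOn
  refine ⟨zero_le_one, fun i => hac _ _ (hx i), fun i => hac _ _ (hy i), hac _ _ ht,
    measurable_const, measurable_const, ae_of_all _ fun s _ i => hx i s,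
    ae_of_all _ fun s _ i => hy i s, ae_of_all _ fun s _ => ?_⟩
  convert ht s using 1
  rw [Finset.mul_sum]
  refine Finset.sum_congr rfl fun i _ => ?_
  simp only [mul_x, mul_y, Pi.add_apply, Pi.smul_apply, smul_eq_mul]
  ring

theorem ccDist_mul_ne_top (p : Heisenberg n) (u v : Fin n → ℝ) :
    ccDist p (p * ⟨u, v, 0⟩) ≠ ⊤ := by
  have h := ccDist_le (isHorizontalCurve_line p u v)
  have h0 : p * (⟨0, 0, 0⟩ : Heisenberg n) = p := mul_one p
  simp only [one_smul, zero_smul, h0] at h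
  refine ne_top_of_le_ne_top ?_ h
  simp [horizontalLength]

theorem ccDist_ne_top (hn : 0 < n) (p q : Heisenberg n) : ccDist p q ≠ ⊤ := by
  have htri : ∀ {p q r : Heisenberg n}, ccDist p q ≠ ⊤ → ccDist q r ≠ ⊤ → ccDist p r ≠ ⊤ :=
    fun h1 h2 => ne_top_of_le_ne_top (ENNReal.add_ne_top.2 ⟨h1, h2⟩) (ccDist_triangle _ _ _)
  set e : Fin n → ℝ := Pi.single ⟨0, hn⟩ 1 with he
  set w : Heisenberg n := p * ⟨q.x - p.x, q.y - p.y, 0⟩ with hw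
  set β : ℝ := (q.t - w.t) / 4 with hβ
  refine htri (ccDist_mul_ne_top p (q.x - p.x) (q.y - p.y)) ?_
  refine htri (ccDist_mul_ne_top w 0 e) ?_
  refine htri (ccDist_mul_ne_top _ (β • e) 0) ?_
  refine htri (ccDist_mul_ne_top _ 0 (-e)) ?_
  convert ccDist_mul_ne_top _ (-(β • e)) 0 using 2
  ext i
  · simp [hw]
  · simp [hw]
  · have hsum : ∀ f : Fin n → ℝ, ∑ j, f j * e j = f ⟨0, hn⟩ := by
      intro f
      simp [he, Pi.single_apply]
    have hee : e ⟨0, hn⟩ = 1 := by simp [he]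
    have h3 := hsum fun j => 2 * β * e j
    have h4 : (∑ j, (w.y j * (0 : ℝ) - w.x j * e j))
        + (∑ j, ((w.y j + e j) * (β * e j) - (w.x j + 0) * 0))
        + (∑ j, ((w.y j + e j + 0) * 0 - (w.x j + 0 + β * e j) * -e j))
        + (∑ j, ((w.y j + e j + 0 + -e j) * -(β * e j) - (w.x j + 0 + β * e j + 0) * 0))
        = ∑ j, 2 * β * e j * e j := by
      simp only [← Finset.sum_add_distrib]
      exact Finset.sum_congr rfl fun j _ => by ring
    simp only [hee] at h3
    simp only [mul_t, mul_x, mul_y, Pi.add_apply, Pi.neg_apply, Pi.smul_apply, Pi.zero_apply,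
      smul_eq_mul]
    rw [h3] at h4
    linarith

/-- `ℍ^n` with the Carnot–Carathéodory metric. -/
@[ext]
structure CC (n : ℕ) where
  pt : Heisenberg n

/-- `ℍ^n` with the Korányi metric. -/
@[ext]
structure Koranyi (n : ℕ) where
  pt : Heisenberg n

noncomputable instance : EMetricSpace (CC n) where
  edist p q := ccDist p.pt q.pt
  edist_self p := by
    have h := ccDist_le (isHorizontalCurve_line p.pt 0 0)
    have h0 : p.pt * (⟨0, 0, 0⟩ : Heisenberg n) = p.pt := mul_one p.pt
    simp only [smul_zero, h0] at h
    exact le_antisymm (h.trans (by simp [horizontalLength])) zero_le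
  edist_comm p q := le_antisymm (ccDist_comm_le _ _) (ccDist_comm_le _ _)
  edist_triangle p q r := ccDist_triangle _ _ _
  eq_of_edist_eq_zero h := CC.ext (eq_of_ccDist_eq_zero h)

noncomputable instance : MetricSpace (Koranyi n) where
  dist p q := koranyiDist p.pt q.pt
  dist_self p := by rw [koranyiDist, inv_mul_cancel, koranyiNorm_one]
  dist_comm p q := by
    rw [koranyiDist, koranyiDist, ← koranyiNorm_inv, mul_inv_rev, inv_inv]
  dist_triangle p q r := by
    have h := koranyiNorm_mul_le (r.pt⁻¹ * q.pt) (q.pt⁻¹ * p.pt)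
    rw [mul_assoc, mul_inv_cancel_left] at h
    rw [add_comm]
    exact h
  eq_of_dist_eq_zero h :=
    Koranyi.ext (inv_mul_eq_one.1 (eq_one_of_koranyiNorm_eq_zero h)).symm

noncomputable instance : MeasurableSpace (CC n) := borel _
instance : BorelSpace (CC n) := ⟨rfl⟩
noncomputable instance : MeasurableSpace (Koranyi n) := borel _
instance : BorelSpace (Koranyi n) := ⟨rfl⟩

end Heisenberg

/-! Let `f = (F, τ)` be `L`-Lipschitz on `E` for the Korányi metric. Then `F` is Lipschitz and the
vertical coordinate `τ q' - τ q - ω (F q) (F q')` of `(f q)⁻¹ * f q'`, where `ω` is twice the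
symplectic form, is at most `L² ‖q - q'‖²`. Near a density point `p` of `E` at which `F` has
derivative `A`, this bound improves to `o(r²)` for `q, q'` in the ball of radius `r`: move from `q`
to `q'` through `N` points of `E` near the segment; the `N` steps contribute `O(r² / N)`, and the
`ω`-areas between them are negligible because `F` maps the chain close to a line. Applied to the
sides of triangles in `E`, it shows that `ω` vanishes on the range of `A`, which is therefore
isotropic and of dimension at most `n`. So at scale `r` the map `f` is `A` up to `o(r)`, its image
is covered by `O(m ^ n)` sets of diameter `O(r / m)` for arbitrarily large `m`, and a Besicovitch
covering by such balls shows that the image is null in every dimension `k > n`. The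
Carnot–Carathéodory metric is bi-Lipschitz equivalent to the Korányi metric. -/

/-! ### Maps with a quadratic contact estimate -/

section Contact

variable {W V : Type*} [NormedAddCommGroup W] [NormedSpace ℝ W] [NormedAddCommGroup V]
  [NormedSpace ℝ V]

/-- The set `E` is asymptotically dense at `p`: at small scales `r`, every point of the ball of
radius `r` around `p` is much closer than `r` to `E`. This is the only consequence of Lebesgue
density used below. -/
def AsymptoticallyDenseAt (E : Set W) (p : W) : Prop :=
  ∀ δ > 0, ∀ᶠ r : ℝ in 𝓝[>] 0, ∀ w ∈ Metric.closedBall p r, ∃ q ∈ E, dist q w ≤ δ * r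

/-- The contact defect of the pair `(F, τ)` between `q` and `q'`. When `F` and `τ` are the
horizontal and the vertical coordinate of a map `f` into the Heisenberg group, this is the vertical
coordinate of `(f q)⁻¹ * f q'`. -/
noncomputable def contactDefect {ι : Type*} (ω : V →L[ℝ] V →L[ℝ] ℝ) (F : ι → V) (τ : ι → ℝ)
    (q q' : ι) : ℝ :=
  τ q' - τ q - ω (F q) (F q')

theorem contactDefect_add {ι : Type*} {ω : V →L[ℝ] V →L[ℝ] ℝ} (hω : ∀ v, ω v v = 0) (F : ι → V)
    (τ : ι → ℝ) (a b c : ι) :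
    contactDefect ω F τ a c = contactDefect ω F τ a b + contactDefect ω F τ b c
      + ω (F b - F a) (F c - F a) := by
  have hba : ω (F b) (F a) = -ω (F a) (F b) := by
    have h := hω (F a + F b)
    simp only [map_add, add_apply, hω] at h
    linarith
  simp only [contactDefect, map_sub, sub_apply, hω, hba]
  ring

theorem contactDefect_eq_sum {ι : Type*} {ω : V →L[ℝ] V →L[ℝ] ℝ} (hω : ∀ v, ω v v = 0) (F : ι → V)
    (τ : ι → ℝ) (x : ℕ → ι) (N : ℕ) :
    contactDefect ω F τ (x 0) (x N) = ∑ j ∈ Finset.range N, contactDefect ω F τ (x j) (x (j + 1))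
      + ∑ j ∈ Finset.range N, ω (F (x j) - F (x 0)) (F (x (j + 1)) - F (x 0)) := by
  induction N with
  | zero => simp [contactDefect, hω]
  | succ N ih =>
    rw [contactDefect_add hω F τ (x 0) (x N), ih, Finset.sum_range_succ, Finset.sum_range_succ]
    ring

theorem abs_bilin_sub_le (ω : V →L[ℝ] V →L[ℝ] ℝ) {u v u' v' : V} {M η : ℝ} (hu : ‖u‖ ≤ M)
    (hv' : ‖v'‖ ≤ M) (hu' : ‖u' - u‖ ≤ η) (hv : ‖v' - v‖ ≤ η) :
    |ω u' v' - ω u v| ≤ 2 * ‖ω‖ * M * η := by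
  have e : ω u' v' - ω u v = ω u (v' - v) + ω (u' - u) v' := by
    simp only [map_sub, sub_apply]
    ring
  calc |ω u' v' - ω u v| ≤ |ω u (v' - v)| + |ω (u' - u) v'| := e ▸ abs_add_le _ _
    _ ≤ ‖ω‖ * M * η + ‖ω‖ * η * M :=
      add_le_add (ω.le_of_opNorm₂_le_of_le le_rfl hu hv) (ω.le_of_opNorm₂_le_of_le le_rfl hu' hv')
    _ = 2 * ‖ω‖ * M * η := by ring

theorem abs_sum_bilin_le_of_near_line {ω : V →L[ℝ] V →L[ℝ] ℝ} (hω : ∀ v, ω v v = 0) {N : ℕ}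
    {u : ℕ → V} {a : V} {M η : ℝ} (ha : ‖a‖ ≤ M) (hη : η ≤ M)
    (hu : ∀ j ≤ N, ‖u j - (j / N : ℝ) • a‖ ≤ η) :
    |∑ j ∈ Finset.range N, ω (u j) (u (j + 1))| ≤ N * (4 * ‖ω‖ * M * η) := by
  have hM : 0 ≤ M := (norm_nonneg a).trans ha
  have hline : ∀ j ≤ N, ‖(j / N : ℝ) • a‖ ≤ M := fun j hj => by
    rw [norm_smul, Real.norm_of_nonneg (by positivity)]
    exact (mul_le_of_le_one_left (norm_nonneg a)
      (div_le_one_of_le₀ (by exact_mod_cast hj) N.cast_nonneg)).trans ha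
  have hterm : ∀ j ∈ Finset.range N, |ω (u j) (u (j + 1))| ≤ 4 * ‖ω‖ * M * η := fun j hj => by
    have hj : j + 1 ≤ N := Finset.mem_range.1 hj
    have hnorm : ‖u (j + 1)‖ ≤ 2 * M := by
      linarith [norm_le_norm_sub_add (u (j + 1)) (((j + 1 : ℕ) / N : ℝ) • a), hu _ hj, hline _ hj]
    have h := abs_bilin_sub_le ω ((hline j (by lia)).trans (by linarith)) hnorm (hu j (by lia))
      (hu (j + 1) hj)
    simp only [map_smul, smul_apply, hω, smul_zero, sub_zero] at h
    linarith
  calc _ ≤ ∑ j ∈ Finset.range N, |ω (u j) (u (j + 1))| := Finset.abs_sum_le_sum_abs _ _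
    _ ≤ (Finset.range N).card • (4 * ‖ω‖ * M * η) := Finset.sum_le_card_nsmul _ _ _ hterm
    _ = N * (4 * ‖ω‖ * M * η) := by rw [Finset.card_range, nsmul_eq_mul]

variable {F : W → V} {A : W →L[ℝ] V} {E : Set W} {p : W}

theorem eventually_norm_sub_sub_map_sub_le (hF : HasFDerivWithinAt F A E p) {δ : ℝ} (hδ : 0 < δ) :
    ∀ᶠ r : ℝ in 𝓝[>] 0, ∀ q ∈ E ∩ Metric.closedBall p r, ∀ q' ∈ E ∩ Metric.closedBall p r,
      ‖F q' - F q - A (q' - q)‖ ≤ δ * r := by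
  have hlittle : ∀ᶠ q in 𝓝[E] p, ‖F q - F p - A (q - p)‖ ≤ δ / 2 * ‖q - p‖ :=
    hF.isLittleO.def (by positivity)
  obtain ⟨ρ, hρ, hball⟩ := Metric.mem_nhdsWithin_iff.1 hlittle
  filter_upwards [Ioo_mem_nhdsGT hρ] with r hr
  have hone : ∀ q ∈ E ∩ Metric.closedBall p r, ‖F q - F p - A (q - p)‖ ≤ δ / 2 * r :=
    fun q hq => (hball ⟨Metric.closedBall_subset_ball hr.2 hq.2, hq.1⟩).trans <| by
      rw [← dist_eq_norm]
      gcongr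
      exact hq.2
  intro q hq q' hq'
  calc ‖F q' - F q - A (q' - q)‖ = ‖(F q' - F p - A (q' - p)) - (F q - F p - A (q - p))‖ := by
        simp only [map_sub]
        congr 1
        abel
    _ ≤ δ / 2 * r + δ / 2 * r := (norm_sub_le _ _).trans (add_le_add (hone q' hq') (hone q hq))
    _ = δ * r := by ring

theorem exists_chain_near_segment {r η : ℝ} (hη : 0 ≤ η)
    (hdense : ∀ w ∈ Metric.closedBall p r, ∃ q ∈ E, dist q w ≤ η) {q q' : W}
    (hq : q ∈ E ∩ Metric.closedBall p r) (hq' : q' ∈ E ∩ Metric.closedBall p r) {N : ℕ}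
    (hN : 0 < N) :
    ∃ x : ℕ → W, x 0 = q ∧ x N = q' ∧
      ∀ j ≤ N, x j ∈ E ∩ Metric.closedBall p (r + η) ∧
        dist (x j) (AffineMap.lineMap q q' (j / N : ℝ)) ≤ η := by
  have hN' : (N : ℝ) ≠ 0 := by exact_mod_cast hN.ne'
  have hpoint : ∀ j : ℕ, ∃ y, (j = 0 → y = q) ∧ (j = N → y = q') ∧
      (j ≤ N → y ∈ E ∧ dist y (AffineMap.lineMap q q' (j / N : ℝ)) ≤ η) := by
    intro j
    by_cases hj0 : j = 0
    · exact ⟨q, fun _ => rfl, fun h => absurd (h.symm.trans hj0) hN.ne',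
        fun _ => ⟨hq.1, by simpa [hj0] using hη⟩⟩
    by_cases hjN : j = N
    · exact ⟨q', fun h => absurd h hj0, fun _ => rfl,
        fun _ => ⟨hq'.1, by simpa [hjN, hN'] using hη⟩⟩
    by_cases hj : j ≤ N
    · obtain ⟨y, hy, hyd⟩ := hdense _ (convex_closedBall p r |>.lineMap_mem hq.2 hq'.2
        (t := (j / N : ℝ)) ⟨by positivity, div_le_one_of_le₀ (by exact_mod_cast hj) N.cast_nonneg⟩)
      exact ⟨y, fun h => absurd h hj0, fun h => absurd h hjN, fun _ => ⟨hy, hyd⟩⟩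
    · exact ⟨q, fun _ => rfl, fun h => absurd h hjN, fun h => absurd h hj⟩
  choose x hx0 hxN hx using hpoint
  refine ⟨x, hx0 0 rfl, hxN N rfl, fun j hj => ⟨⟨(hx j hj).1, ?_⟩, (hx j hj).2⟩⟩
  have hw : AffineMap.lineMap q q' (j / N : ℝ) ∈ Metric.closedBall p r :=
    convex_closedBall p r |>.lineMap_mem hq.2 hq'.2
      ⟨by positivity, div_le_one_of_le₀ (by exact_mod_cast hj) N.cast_nonneg⟩
  exact (dist_triangle _ _ _).trans (by linarith [(hx j hj).2, Metric.mem_closedBall.1 hw])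

theorem dist_le_of_near_segment {q q' : W} {N j : ℕ} {r η : ℝ} (hqq' : dist q q' ≤ 2 * r)
    (hη : η ≤ r / N) {y y' : W} (hy : dist y (AffineMap.lineMap q q' (j / N : ℝ)) ≤ η)
    (hy' : dist y' (AffineMap.lineMap q q' ((j + 1 : ℕ) / N : ℝ)) ≤ η) :
    dist y y' ≤ 4 * (r / N) := by
  have hline : dist (AffineMap.lineMap q q' (j / N : ℝ))
      (AffineMap.lineMap q q' ((j + 1 : ℕ) / N : ℝ)) ≤ 2 * (r / N) := by
    have hgap : dist (j / N : ℝ) ((j + 1 : ℕ) / N : ℝ) = 1 / N := by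
      rw [Real.dist_eq, ← sub_div, Nat.cast_succ, sub_add_cancel_left, abs_div, abs_neg, abs_one,
        Nat.abs_cast]
    rw [dist_lineMap_lineMap, hgap, one_div_mul_eq_div, mul_div_assoc']
    gcongr
  linarith [dist_triangle4_right y y' (AffineMap.lineMap q q' (j / N : ℝ))
    (AffineMap.lineMap q q' ((j + 1 : ℕ) / N : ℝ))]

theorem norm_sub_sub_smul_le_of_near_segment {q q' y : W} {t η : ℝ}
    (hF : ‖F y - F q - A (y - q)‖ ≤ η) (hy : dist y (AffineMap.lineMap q q' t) ≤ η) :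
    ‖F y - F q - t • A (q' - q)‖ ≤ (1 + ‖A‖) * η := by
  have e : F y - F q - t • A (q' - q) = F y - F q - A (y - q)
      + A (y - AffineMap.lineMap q q' t) := by
    simp only [AffineMap.lineMap_apply_module', map_sub, map_add, map_smul]
    abel
  rw [e, add_mul, one_mul]
  exact (norm_add_le _ _).trans
    (add_le_add hF (A.le_opNorm_of_le ((dist_eq_norm _ _).symm.trans_le hy)))

/-- Move from `q` to `q'` in `N` steps of length about `r / N` along a chain of points of `E` near
the segment. Every step contributes at most `L (r / N) ^ 2` to the contact defect, and the bilinear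
cross terms cancel to first order because `F` maps the chain close to a line. -/
theorem abs_contactDefect_le_of_chain {ω : V →L[ℝ] V →L[ℝ] ℝ} (hω : ∀ v, ω v v = 0) {τ : W → ℝ}
    {L : ℝ≥0} (hτ : ∀ q ∈ E, ∀ q' ∈ E, |contactDefect ω F τ q q'| ≤ L * dist q q' ^ 2) {N : ℕ}
    (hN : 0 < N) {r : ℝ} (hr : 0 ≤ r)
    (hdense : ∀ w ∈ Metric.closedBall p r, ∃ q ∈ E, dist q w ≤ r / N ^ 2)
    (hdiff : ∀ q ∈ E ∩ Metric.closedBall p (2 * r), ∀ q' ∈ E ∩ Metric.closedBall p (2 * r),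
      ‖F q' - F q - A (q' - q)‖ ≤ r / N ^ 2)
    {q q' : W} (hq : q ∈ E ∩ Metric.closedBall p r) (hq' : q' ∈ E ∩ Metric.closedBall p r) :
    |contactDefect ω F τ q q'| ≤ 16 * (L + ‖ω‖ * (1 + ‖A‖) ^ 2) * r ^ 2 / N := by
  have hN1 : (1 : ℝ) ≤ N := by exact_mod_cast hN
  have hη : r / N ^ 2 ≤ r / N :=
    div_le_div_of_nonneg_left hr (by positivity) (by nlinarith)
  have hηr : r / N ^ 2 ≤ r := div_le_self hr (one_le_pow₀ hN1)
  have hqq' : dist q q' ≤ 2 * r := by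
    linarith [dist_triangle_right q q' p, Metric.mem_closedBall.1 hq.2,
      Metric.mem_closedBall.1 hq'.2]
  obtain ⟨x, rfl, rfl, hx⟩ := exists_chain_near_segment (by positivity) hdense hq hq' hN
  have hx2 : ∀ j ≤ N, x j ∈ E ∩ Metric.closedBall p (2 * r) := fun j hj =>
    ⟨(hx j hj).1.1, Metric.closedBall_subset_closedBall (by linarith) (hx j hj).1.2⟩
  have hstep : ∀ j ∈ Finset.range N,
      |contactDefect ω F τ (x j) (x (j + 1))| ≤ L * (4 * (r / N)) ^ 2 := by
    intro j hj
    have hj : j + 1 ≤ N := Finset.mem_range.1 hj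
    refine (hτ _ (hx2 j (by lia)).1 _ (hx2 _ hj).1).trans ?_
    gcongr
    exact dist_le_of_near_segment hqq' hη (hx j (by lia)).2 (hx (j + 1) hj).2
  have hA : ‖A (x N - x 0)‖ ≤ 2 * (1 + ‖A‖) * r := by
    refine (A.le_opNorm_of_le ((dist_eq_norm' _ _).symm.trans_le hqq')).trans ?_
    nlinarith
  have hnear : ∀ j ≤ N, ‖F (x j) - F (x 0) - (j / N : ℝ) • A (x N - x 0)‖
      ≤ (1 + ‖A‖) * (r / N ^ 2) := fun j hj =>
    norm_sub_sub_smul_le_of_near_segment (hdiff _ (hx2 0 hN.le) _ (hx2 j hj)) (hx j hj).2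
  have hcross := abs_sum_bilin_le_of_near_line hω (N := N) hA
    (by nlinarith [norm_nonneg A] : (1 + ‖A‖) * (r / N ^ 2) ≤ 2 * (1 + ‖A‖) * r) hnear
  rw [contactDefect_eq_sum hω F τ x N]
  calc _ ≤ N • (L * (4 * (r / N)) ^ 2)
        + N * (4 * ‖ω‖ * (2 * (1 + ‖A‖) * r) * ((1 + ‖A‖) * (r / N ^ 2))) := by
        refine (abs_add_le _ _).trans (add_le_add ?_ hcross)
        refine (Finset.abs_sum_le_sum_abs _ _).trans ?_
        simpa using Finset.sum_le_card_nsmul _ _ _ hstep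
    _ = (16 * L + 8 * ‖ω‖ * (1 + ‖A‖) ^ 2) * r ^ 2 / N := by
        rw [nsmul_eq_mul]
        field_simp
        ring
    _ ≤ _ := by
        gcongr
        nlinarith [mul_nonneg (norm_nonneg ω) (sq_nonneg (1 + ‖A‖))]

theorem eventually_abs_contactDefect_le {ω : V →L[ℝ] V →L[ℝ] ℝ} (hω : ∀ v, ω v v = 0) {τ : W → ℝ}
    {L : ℝ≥0} (hτ : ∀ q ∈ E, ∀ q' ∈ E, |contactDefect ω F τ q q'| ≤ L * dist q q' ^ 2)
    (hE : AsymptoticallyDenseAt E p) (hF : HasFDerivWithinAt F A E p) {ε : ℝ} (hε : 0 < ε) :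
    ∀ᶠ r : ℝ in 𝓝[>] 0, ∀ q ∈ E ∩ Metric.closedBall p r, ∀ q' ∈ E ∩ Metric.closedBall p r,
      |contactDefect ω F τ q q'| ≤ ε * r ^ 2 := by
  obtain ⟨N, hN⟩ := exists_nat_gt (16 * (L + ‖ω‖ * (1 + ‖A‖) ^ 2) / ε)
  have hN0 : (0 : ℝ) < N := lt_of_le_of_lt (by positivity) hN
  filter_upwards [hE (1 / N ^ 2) (by positivity), eventually_nhdsGT_zero_mul_left two_pos
    (eventually_norm_sub_sub_map_sub_le hF (δ := 1 / (2 * N ^ 2)) (by positivity)),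
    self_mem_nhdsWithin] with r hdense hdiff hr q hq q' hq'
  have hdense' : ∀ w ∈ Metric.closedBall p r, ∃ q ∈ E, dist q w ≤ r / N ^ 2 := by
    simpa only [one_div_mul_eq_div] using hdense
  have e : 1 / (2 * (N : ℝ) ^ 2) * (2 * r) = r / N ^ 2 := by field_simp
  calc _ ≤ 16 * (L + ‖ω‖ * (1 + ‖A‖) ^ 2) * r ^ 2 / N :=
        abs_contactDefect_le_of_chain hω hτ (by exact_mod_cast hN0) (le_of_lt hr) hdense'
          (e ▸ hdiff) hq hq'
    _ = 16 * (L + ‖ω‖ * (1 + ‖A‖) ^ 2) / N * r ^ 2 := by ring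
    _ ≤ ε * r ^ 2 := by
      gcongr
      exact (div_le_comm₀ hε hN0).1 hN.le

theorem eventually_infDist_add_smul_le (hE : AsymptoticallyDenseAt E p) (v : W) {δ : ℝ}
    (hδ : 0 < δ) : ∀ᶠ r : ℝ in 𝓝[>] 0, Metric.infDist (p + r • v) E ≤ δ * r := by
  have hc : 0 < ‖v‖ + 1 := by positivity
  filter_upwards [eventually_nhdsGT_zero_mul_left hc (hE (δ / (‖v‖ + 1)) (by positivity)),
    self_mem_nhdsWithin] with r hdense hr
  obtain ⟨q, hq, hqd⟩ := hdense (p + r • v) <| by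
    rw [mem_closedBall_iff_norm, add_sub_cancel_left, norm_smul, Real.norm_of_nonneg (le_of_lt hr),
      mul_comm]
    exact mul_le_mul_of_nonneg_right (by linarith) (le_of_lt hr)
  calc Metric.infDist (p + r • v) E ≤ dist q (p + r • v) :=
        dist_comm q _ ▸ Metric.infDist_le_dist_of_mem hq
    _ ≤ δ / (‖v‖ + 1) * ((‖v‖ + 1) * r) := hqd
    _ = δ * r := by field_simp

theorem exists_tendsto_inv_smul (hp : p ∈ E) (hE : AsymptoticallyDenseAt E p) (v : W) :
    ∃ d : ℝ → W, (∀ᶠ r in 𝓝[>] 0, p + d r ∈ E) ∧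
      Tendsto (fun r => r⁻¹ • d r) (𝓝[>] 0) (𝓝 v) := by
  have hnear : ∀ r : ℝ, ∃ d, 0 < r →
      p + d ∈ E ∧ dist (p + r • v) (p + d) < Metric.infDist (p + r • v) E + r ^ 2 := by
    intro r
    by_cases hr : 0 < r
    · obtain ⟨q, hq, hqd⟩ := (Metric.infDist_lt_iff ⟨p, hp⟩).1
        (lt_add_of_pos_right (Metric.infDist (p + r • v) E) (pow_pos hr 2))
      exact ⟨q - p, fun _ => by simpa using ⟨hq, hqd⟩⟩
    · exact ⟨0, fun h => absurd h hr⟩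
  choose d hd using hnear
  refine ⟨d, by filter_upwards [self_mem_nhdsWithin] with r hr using (hd r hr).1,
    Metric.tendsto_nhds.2 fun ε hε => ?_⟩
  filter_upwards [eventually_infDist_add_smul_le hE v (half_pos hε), Ioo_mem_nhdsGT (half_pos hε)]
    with r hinf hr
  have hr0 : 0 < r := hr.1
  have hdist : dist (d r) (r • v) < ε * r := by
    have h := (hd r hr0).2
    rw [dist_add_left, dist_comm] at h
    nlinarith [hr.2]
  rwa [← inv_smul_smul₀ hr0.ne' v, dist_smul₀, norm_inv, Real.norm_of_nonneg hr0.le,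
    inv_mul_lt_iff₀ hr0, mul_comm]

theorem tendsto_zero_of_tendsto_inv_smul {d : ℝ → W} {v : W}
    (hd : Tendsto (fun r => r⁻¹ • d r) (𝓝[>] 0) (𝓝 v)) : Tendsto d (𝓝[>] 0) (𝓝 0) := by
  have h := (tendsto_id.mono_left nhdsWithin_le_nhds).smul hd
  rw [zero_smul] at h
  refine h.congr' ?_
  filter_upwards [self_mem_nhdsWithin] with r hr using smul_inv_smul₀ (ne_of_gt hr) _

theorem eventually_norm_le_of_tendsto_inv_smul {d : ℝ → W} {v : W}
    (hd : Tendsto (fun r => r⁻¹ • d r) (𝓝[>] 0) (𝓝 v)) {c : ℝ} (hv : ‖v‖ < c) :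
    ∀ᶠ r in 𝓝[>] 0, ‖d r‖ ≤ c * r := by
  filter_upwards [hd.norm.eventually (gt_mem_nhds hv), self_mem_nhdsWithin] with r hr hr0
  rw [norm_smul, norm_inv, Real.norm_of_nonneg (le_of_lt hr0), inv_mul_lt_iff₀ hr0, mul_comm] at hr
  exact hr.le

/-- The contact defects between three points of `E` near `p` are `o(r²)`, hence so is the value of
`ω` on the increments of `F`; rescaling by `r⁻¹` gives the value on their limits. -/
theorem bilin_fderivWithin_eq_zero {ω : V →L[ℝ] V →L[ℝ] ℝ} (hω : ∀ v, ω v v = 0) {τ : W → ℝ}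
    {L : ℝ≥0} (hτ : ∀ q ∈ E, ∀ q' ∈ E, |contactDefect ω F τ q q'| ≤ L * dist q q' ^ 2)
    (hp : p ∈ E) (hE : AsymptoticallyDenseAt E p) (hF : HasFDerivWithinAt F A E p) (v w : W) :
    ω (A v) (A w) = 0 := by
  obtain ⟨d, hd, hdv⟩ := exists_tendsto_inv_smul hp hE v
  obtain ⟨d', hd', hdw⟩ := exists_tendsto_inv_smul hp hE w
  have hlim : Tendsto (fun r : ℝ => ω (r⁻¹ • (F (p + d r) - F p)) (r⁻¹ • (F (p + d' r) - F p)))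
      (𝓝[>] 0) (𝓝 (ω (A v) (A w))) :=
    (ω.continuous₂.tendsto (A v, A w)).comp <|
      (hF.lim (tendsto_zero_of_tendsto_inv_smul hdv) hd hdv).prodMk_nhds
        (hF.lim (tendsto_zero_of_tendsto_inv_smul hdw) hd' hdw)
  refine tendsto_nhds_unique hlim (Metric.tendsto_nhds.2 fun ε hε => ?_)
  set c : ℝ := ‖v‖ + ‖w‖ + 1
  have hc : 0 < c := by positivity
  have hvc : ‖v‖ < c := by grind [norm_nonneg w]
  have hwc : ‖w‖ < c := by grind [norm_nonneg v]
  filter_upwards [hd, hd', eventually_norm_le_of_tendsto_inv_smul hdv hvc,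
    eventually_norm_le_of_tendsto_inv_smul hdw hwc, self_mem_nhdsWithin,
    eventually_nhdsGT_zero_mul_left hc (eventually_abs_contactDefect_le hω hτ hE hF
      (ε := ε / (4 * c ^ 2)) (by positivity))] with r hq hq' hdr hdr' hr hdefect
  have hr0 : 0 < r := hr
  have hsq : ε / (4 * c ^ 2) * (c * r) ^ 2 = ε * r ^ 2 / 4 := by field_simp
  rw [hsq] at hdefect
  have hpB : p ∈ E ∩ Metric.closedBall p (c * r) := ⟨hp, Metric.mem_closedBall_self (by positivity)⟩
  have hqB : p + d r ∈ E ∩ Metric.closedBall p (c * r) := ⟨hq, by simpa using hdr⟩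
  have hqB' : p + d' r ∈ E ∩ Metric.closedBall p (c * r) := ⟨hq', by simpa using hdr'⟩
  have hbound : |ω (F (p + d r) - F p) (F (p + d' r) - F p)| < ε * r ^ 2 := by
    have hadd := contactDefect_add hω F τ p (p + d r) (p + d' r)
    have h₁ := abs_le.1 (hdefect p hpB _ hqB)
    have h₂ := abs_le.1 (hdefect p hpB _ hqB')
    have h₃ := abs_le.1 (hdefect _ hqB _ hqB')
    rw [abs_lt]
    constructor <;> nlinarith [mul_pos hε (pow_pos hr0 2)]
  simp only [map_smul, smul_apply, smul_eq_mul, dist_zero_right, norm_mul, norm_inv,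
    Real.norm_of_nonneg hr0.le]
  rwa [inv_mul_lt_iff₀ hr0, inv_mul_lt_iff₀ hr0, Real.norm_eq_abs, ← mul_assoc, ← sq, mul_comm]

theorem eventually_norm_sub_le_and_abs_contactDefect_le {ω : V →L[ℝ] V →L[ℝ] ℝ}
    (hω : ∀ v, ω v v = 0) {τ : W → ℝ} {L : ℝ≥0}
    (hτ : ∀ q ∈ E, ∀ q' ∈ E, |contactDefect ω F τ q q'| ≤ L * dist q q' ^ 2)
    (hE : AsymptoticallyDenseAt E p) (hF : HasFDerivWithinAt F A E p) {ε : ℝ} (hε : 0 < ε) :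
    ∀ᶠ r : ℝ in 𝓝[>] 0, ∀ q ∈ E ∩ Metric.closedBall p r, ∀ q' ∈ E ∩ Metric.closedBall p r,
      ‖F q' - F q‖ ≤ ‖A (q' - q)‖ + ε * r ∧ |contactDefect ω F τ q q'| ≤ (ε * r) ^ 2 := by
  filter_upwards [eventually_norm_sub_sub_map_sub_le hF hε,
    eventually_abs_contactDefect_le hω hτ hE hF (pow_pos hε 2)] with r hdiff hdefect q hq q' hq'
  refine ⟨?_, by simpa only [mul_pow] using hdefect q hq q' hq'⟩
  linarith [norm_le_norm_sub_add (F q' - F q) (A (q' - q)), hdiff q hq q' hq']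

end Contact

/-! ### Hausdorff measure of maps with zero content density -/

section Content

variable {X : Type*} [EMetricSpace X]

/-- The `d`-dimensional Hausdorff content at scale `ρ`: the infimum of `∑ (diam Sᵢ) ^ d` over
countable covers by sets `Sᵢ` of diameter at most `ρ`. The Hausdorff measure is its supremum over
`ρ > 0`. -/
noncomputable def hausdorffContent (d : ℕ) (ρ : ℝ≥0∞) : OuterMeasure X :=
  OuterMeasure.mkMetric'.pre (fun s => Metric.ediam s ^ (d : ℝ)) ρ

theorem hausdorffContent_le_ediam_pow {d : ℕ} {ρ : ℝ≥0∞} {s : Set X} (hs : Metric.ediam s ≤ ρ) :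
    hausdorffContent d ρ s ≤ Metric.ediam s ^ d :=
  (OuterMeasure.mkMetric'.pre_le hs).trans_eq (ENNReal.rpow_natCast _ d)

theorem hausdorffContent_anti (d : ℕ) {ρ ρ' : ℝ≥0∞} (h : ρ ≤ ρ') (s : Set X) :
    hausdorffContent d ρ' s ≤ hausdorffContent d ρ s :=
  OuterMeasure.mkMetric'.mono_pre _ h s

theorem hausdorffMeasure_eq_zero_of_hausdorffContent [MeasurableSpace X] [BorelSpace X] {d : ℕ}
    {s : Set X} (h : ∀ ρ : ℝ, 0 < ρ → hausdorffContent d (ENNReal.ofReal ρ) s = 0) :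
    Measure.hausdorffMeasure (d : ℝ) s = 0 := by
  rw [Measure.hausdorffMeasure, ← Measure.toOuterMeasure_apply, Measure.mkMetric_toOuterMeasure]
  simp only [OuterMeasure.mkMetric, OuterMeasure.mkMetric', OuterMeasure.iSup_apply]
  refine ENNReal.iSup_eq_zero.2 fun ρ => ENNReal.iSup_eq_zero.2 fun hρ => ?_
  obtain ⟨ρ', hρ', hlt⟩ := ENNReal.lt_iff_exists_nnreal_btwn.1 hρ
  exact le_zero_iff.1 ((hausdorffContent_anti d hlt.le s).trans_eq
    (ENNReal.ofReal_coe_nnreal (p := ρ') ▸ h ρ' (by exact_mod_cast hρ')))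

theorem hausdorffContent_le_card_mul_pow {ι : Type*} [Fintype ι] {d : ℕ} {ρ δ : ℝ≥0∞} (hδ : δ ≤ ρ)
    {s : Set X} {S : ι → Set X} (hs : s ⊆ ⋃ i, S i) (hS : ∀ i, Metric.ediam (S i) ≤ δ) :
    hausdorffContent d ρ s ≤ Fintype.card ι * δ ^ d := by
  calc hausdorffContent d ρ s ≤ ∑ i, hausdorffContent d ρ (S i) :=
        (measure_mono hs).trans (measure_iUnion_fintype_le _ _)
    _ ≤ ∑ _i : ι, δ ^ d := Finset.sum_le_sum fun i _ =>
        (hausdorffContent_le_ediam_pow ((hS i).trans hδ)).trans (pow_le_pow_left' (hS i) d)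
    _ = Fintype.card ι * δ ^ d := by rw [Finset.sum_const, Finset.card_univ, nsmul_eq_mul]

/-- The part of `E` in the ball of radius `r` around `p` has image of Hausdorff content (at scale
`r`) `o(r ^ d)`. -/
def HasZeroContentDensityAt {W : Type*} [PseudoMetricSpace W] (d : ℕ) (f : W → X) (E : Set W)
    (p : W) : Prop :=
  ∀ ε : ℝ≥0, 0 < ε → ∀ᶠ r : ℝ in 𝓝[>] 0,
    hausdorffContent d (ENNReal.ofReal r) (f '' (E ∩ Metric.closedBall p r))
      ≤ ε * ENNReal.ofReal (r ^ d)

variable {W : Type*} [NormedAddCommGroup W] [NormedSpace ℝ W] [FiniteDimensional ℝ W]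
  [MeasurableSpace W] [BorelSpace W] {f : W → X} {E : Set W}

theorem hausdorffContent_image_le (μ : Measure W) [μ.IsAddHaarMeasure]
    (hE : ∀ p ∈ E, HasZeroContentDensityAt (Module.finrank ℝ W) f E p) {ρ : ℝ} (hρ : 0 < ρ)
    {ε : ℝ≥0} (hε : 0 < ε) :
    hausdorffContent (Module.finrank ℝ W) (ENNReal.ofReal ρ) (f '' E) * μ (Metric.ball 0 1)
      ≤ ε * (μ E + 1) := by
  set d := Module.finrank ℝ W
  obtain ⟨t, r, ht, -, hr, hcover, hsum⟩ := Besicovitch.exists_closedBall_covering_tsum_measure_le μ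
    one_ne_zero (fun p => {r | 0 < r ∧ r ≤ ρ ∧ hausdorffContent d (ENNReal.ofReal r)
      (f '' (E ∩ Metric.closedBall p r)) ≤ ε * ENNReal.ofReal (r ^ d)}) E
    fun p hp δ hδ => by
      obtain ⟨r, hr, hrδ⟩ := ((hE p hp ε hε).and (Ioo_mem_nhdsGT (lt_min hδ hρ))).exists
      exact ⟨r, ⟨hrδ.1, (hrδ.2.trans_le (min_le_right _ _)).le, hr⟩, hrδ.1,
        hrδ.2.trans_le (min_le_left _ _)⟩
  have hcover' : f '' E ⊆ ⋃ p ∈ t, f '' (E ∩ Metric.closedBall p (r p)) := by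
    rw [← image_iUnion₂, ← inter_iUnion₂]
    exact image_mono (subset_inter subset_rfl hcover)
  have hcell : ∀ p : t, hausdorffContent d (ENNReal.ofReal ρ)
      (f '' (E ∩ Metric.closedBall (p : W) (r p))) * μ (Metric.ball 0 1)
        ≤ ε * μ (Metric.closedBall (p : W) (r p)) := fun p => by
    obtain ⟨hr0, hrρ, hcontent⟩ := hr p p.2
    rw [Measure.addHaar_closedBall μ _ hr0.le, ← mul_assoc]
    gcongr
    exact (hausdorffContent_anti d (ENNReal.ofReal_le_ofReal hrρ) _).trans hcontent
  calc _ ≤ (∑' p : t, hausdorffContent d (ENNReal.ofReal ρ)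
        (f '' (E ∩ Metric.closedBall (p : W) (r p)))) * μ (Metric.ball 0 1) := by
        gcongr
        exact (measure_mono hcover').trans (measure_biUnion_le _ ht _)
    _ ≤ ∑' p : t, ε * μ (Metric.closedBall (p : W) (r p)) := by
        rw [← ENNReal.tsum_mul_right]
        exact ENNReal.tsum_le_tsum hcell
    _ ≤ ε * (μ E + 1) := by
        rw [ENNReal.tsum_mul_left]
        gcongr

variable [MeasurableSpace X] [BorelSpace X]

theorem hausdorffMeasure_image_eq_zero_of_measure_ne_top (μ : Measure W) [μ.IsAddHaarMeasure]
    (hμE : μ E ≠ ⊤) (hE : ∀ p ∈ E, HasZeroContentDensityAt (Module.finrank ℝ W) f E p) :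
    Measure.hausdorffMeasure (Module.finrank ℝ W : ℝ) (f '' E) = 0 := by
  refine hausdorffMeasure_eq_zero_of_hausdorffContent fun ρ hρ => ?_
  have hball : μ (Metric.ball 0 1) ≠ 0 := (Metric.measure_ball_pos μ _ one_pos).ne'
  refine (mul_eq_zero.1 ?_).resolve_right hball
  have hlim : Tendsto (fun ε : ℝ≥0 => (ε : ℝ≥0∞) * (μ E + 1)) (𝓝[>] 0) (𝓝 0) := by
    have hcoe : Tendsto (fun ε : ℝ≥0 => (ε : ℝ≥0∞)) (𝓝[>] 0) (𝓝 0) :=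
      (ENNReal.tendsto_coe.2 tendsto_id).mono_left nhdsWithin_le_nhds
    simpa using ENNReal.Tendsto.mul_const hcoe (b := μ E + 1) (Or.inr (by simpa using hμE))
  refine le_zero_iff.1 (ge_of_tendsto hlim ?_)
  filter_upwards [self_mem_nhdsWithin] with ε hε using hausdorffContent_image_le μ hE hρ hε

theorem hausdorffMeasure_image_eq_zero (μ : Measure W) [μ.IsAddHaarMeasure]
    (hnull : ∀ N ⊆ E, μ N = 0 → Measure.hausdorffMeasure (Module.finrank ℝ W : ℝ) (f '' N) = 0)
    (hE : ∀ᵐ p ∂μ, p ∈ E → HasZeroContentDensityAt (Module.finrank ℝ W) f E p) :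
    Measure.hausdorffMeasure (Module.finrank ℝ W : ℝ) (f '' E) = 0 := by
  set G : Set W := {p ∈ E | HasZeroContentDensityAt (Module.finrank ℝ W) f E p}
  have hnotG : μ (E \ G) = 0 := by
    refine measure_mono_null (fun p hp => ?_) (ae_iff.1 hE)
    exact fun hgood => hp.2 ⟨hp.1, hgood hp.1⟩
  have hcover : f '' E ⊆ f '' (E \ G) ∪ ⋃ m : ℕ, f '' (G ∩ Metric.closedBall 0 m) := by
    rw [← image_iUnion, ← inter_iUnion, Metric.iUnion_closedBall_nat, inter_univ, ← image_union]
    exact image_mono fun p hp => (em (p ∈ G)).symm.imp_left fun h => ⟨hp, h⟩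
  refine measure_mono_null hcover (measure_union_null (hnull _ sdiff_subset hnotG)
    (measure_iUnion_null fun m => hausdorffMeasure_image_eq_zero_of_measure_ne_top μ ?_ ?_))
  · exact ((measure_mono inter_subset_right).trans_lt measure_closedBall_lt_top).ne
  · intro p hp ε hε
    filter_upwards [hp.1.2 ε hε] with r hr
    exact (measure_mono (image_mono (inter_subset_inter_left _ fun q hq => hq.1.1))).trans hr

end Content

section LowRank

theorem exists_cover_closedBall_pi {j m : ℕ} (hm : 0 < m) {R : ℝ} (hR : 0 < R) :
    ∃ S : (Fin j → Finset.Icc (-m : ℤ) m) → Set (Fin j → ℝ),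
      Metric.closedBall 0 R ⊆ ⋃ g, S g ∧ ∀ g, ∀ y ∈ S g, ∀ y' ∈ S g, dist y y' ≤ R / m := by
  have hm' : (0 : ℝ) < m := by exact_mod_cast hm
  refine ⟨fun g => {y | ∀ i, ⌊m / R * y i⌋ = g i}, fun y hy => ?_, fun g y hy y' hy' => ?_⟩
  · have hmem : ∀ i, ⌊m / R * y i⌋ ∈ Finset.Icc (-m : ℤ) m := by
      intro i
      have hyi : |y i| ≤ R := (norm_le_pi_norm y i).trans (mem_closedBall_zero_iff.1 hy)
      have hscaled : |m / R * y i| ≤ m := by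
        rw [abs_mul, abs_of_pos (by positivity), div_mul_eq_mul_div, div_le_iff₀ hR]
        gcongr
      refine Finset.mem_Icc.2 ⟨Int.le_floor.2 ?_, ?_⟩
      · exact_mod_cast (abs_le.1 hscaled).1
      · exact_mod_cast (Int.floor_le _).trans (abs_le.1 hscaled).2
    exact mem_iUnion.2 ⟨fun i => ⟨_, hmem i⟩, fun i => rfl⟩
  · refine (dist_pi_le_iff (by positivity)).2 fun i => ?_
    have hfloor := Int.abs_sub_lt_one_of_floor_eq_floor ((hy i).trans (hy' i).symm)
    rw [← mul_sub, abs_mul, abs_of_pos (by positivity), div_mul_eq_mul_div, div_lt_one hR] at hfloor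
    rw [Real.dist_eq, le_div_iff₀ hm']
    linarith

theorem exists_clm_pi_finrank_range {W V : Type*} [NormedAddCommGroup W] [NormedSpace ℝ W]
    [FiniteDimensional ℝ W] [NormedAddCommGroup V] [NormedSpace ℝ V] (A : W →L[ℝ] V) :
    ∃ (M : W →L[ℝ] (Fin (Module.finrank ℝ A.range) → ℝ)) (c : ℝ≥0), ∀ x, ‖A x‖ ≤ c * ‖M x‖ := by
  let e : A.range ≃L[ℝ] (Fin (Module.finrank ℝ A.range) → ℝ) :=
    ContinuousLinearEquiv.ofFinrankEq (by simp)
  let g : (Fin (Module.finrank ℝ A.range) → ℝ) →L[ℝ] A.range := e.symm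
  refine ⟨(e : A.range →L[ℝ] _) ∘L A.rangeRestrict, ‖g‖₊, fun x => ?_⟩
  have hx : g (e (A.rangeRestrict x)) = A.rangeRestrict x := e.symm_apply_apply _
  calc ‖A x‖ = ‖g (e (A.rangeRestrict x))‖ := by rw [hx]; rfl
    _ ≤ ‖g‖ * ‖e (A.rangeRestrict x)‖ := g.le_opNorm _

variable {X W : Type*} [EMetricSpace X] [NormedAddCommGroup W] [NormedSpace ℝ W]

theorem hausdorffContent_image_le_of_edist_le {j : ℕ} (M : W →L[ℝ] (Fin j → ℝ)) {f : W → X}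
    {s : Set W} {p : W} {r : ℝ} (hr : 0 < r) (hs : s ⊆ Metric.closedBall p r) {m : ℕ} (hm : 0 < m)
    {C : ℝ} (hC : 0 ≤ C) (hf : ∀ q ∈ s, ∀ q' ∈ s, edist (f q) (f q')
      ≤ ENNReal.ofReal (C * (‖M (q' - q)‖ + r / m))) (hm' : C * (‖M‖ + 2) ≤ m) (d : ℕ) :
    hausdorffContent d (ENNReal.ofReal r) (f '' s)
      ≤ (2 * m + 1 : ℕ) ^ j * ENNReal.ofReal (C * (‖M‖ + 2) / m * r) ^ d := by
  have hm0 : (0 : ℝ) < m := by exact_mod_cast hm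
  obtain ⟨S, hcover, hdist⟩ := exists_cover_closedBall_pi (j := j) hm
    (R := (‖M‖ + 1) * r) (by positivity)
  have himage : f '' s ⊆ ⋃ g, f '' {q ∈ s | M (q - p) ∈ S g} := by
    rintro _ ⟨q, hq, rfl⟩
    have hball : M (q - p) ∈ Metric.closedBall 0 ((‖M‖ + 1) * r) := by
      rw [mem_closedBall_zero_iff]
      have := M.le_opNorm_of_le (mem_closedBall_iff_norm.1 (hs hq))
      linarith
    obtain ⟨g, hg⟩ := mem_iUnion.1 (hcover hball)
    exact mem_iUnion.2 ⟨g, q, ⟨hq, hg⟩, rfl⟩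
  have hdiam : ∀ g, Metric.ediam (f '' {q ∈ s | M (q - p) ∈ S g})
      ≤ ENNReal.ofReal (C * (‖M‖ + 2) / m * r) := by
    refine fun g => Metric.ediam_le ?_
    rintro _ ⟨q, ⟨hq, hqg⟩, rfl⟩ _ ⟨q', ⟨hq', hqg'⟩, rfl⟩
    refine (hf q hq q' hq').trans (ENNReal.ofReal_le_ofReal ?_)
    have hM : ‖M (q' - q)‖ ≤ (‖M‖ + 1) * r / m := by
      simpa [dist_eq_norm, ← map_sub] using hdist g _ hqg' _ hqg
    calc C * (‖M (q' - q)‖ + r / m) ≤ C * ((‖M‖ + 1) * r / m + r / m) := by gcongr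
      _ = C * (‖M‖ + 2) / m * r := by ring
  have hcard : Fintype.card (Fin j → Finset.Icc (-m : ℤ) m) = (2 * m + 1) ^ j := by
    have : (m + 1 - -m : ℤ).toNat = 2 * m + 1 := by lia
    rw [Fintype.card_fun, Fintype.card_coe, Fintype.card_fin, Int.card_Icc, this]
  have hscale : ENNReal.ofReal (C * (‖M‖ + 2) / m * r) ≤ ENNReal.ofReal r :=
    ENNReal.ofReal_le_ofReal
      (mul_le_of_le_one_left hr.le (div_le_one_of_le₀ hm' hm0.le))
  refine (hausdorffContent_le_card_mul_pow hscale himage hdiam).trans_eq ?_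
  rw [hcard, Nat.cast_pow]

theorem three_mul_pow_le_of_lt {j d m : ℕ} (hjd : j < d) (hm : 0 < m) {D ε r : ℝ} (hD : 0 ≤ D)
    (hr : 0 ≤ r) (hmε : 3 ^ j * D ^ d ≤ ε * m) :
    (2 * m + 1) ^ j * (D / m * r) ^ d ≤ ε * r ^ d := by
  have hm1 : (1 : ℝ) ≤ m := by exact_mod_cast hm
  calc (2 * m + 1) ^ j * (D / m * r) ^ d ≤ (3 * m) ^ j * (D / m * r) ^ d := by gcongr; linarith
    _ = 3 ^ j * D ^ d * m ^ j / m ^ d * r ^ d := by ring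
    _ ≤ ε * m * m ^ j / m ^ d * r ^ d := by gcongr
    _ = ε * (m ^ (j + 1) / m ^ d) * r ^ d := by ring
    _ ≤ ε * 1 * r ^ d := by
      have hεm : 0 ≤ ε * m := le_trans (by positivity) hmε
      have hε : 0 ≤ ε := nonneg_of_mul_nonneg_left hεm (by positivity)
      gcongr
      exact div_le_one_of_le₀ (pow_le_pow_right₀ hm1 hjd) (by positivity)
    _ = ε * r ^ d := by rw [mul_one]

/-- Cover the image of the ball by `O(m ^ rank A)` sets of diameter `O(r / m)` and let `m → ∞`. -/
theorem hasZeroContentDensityAt_of_finrank_range_lt [FiniteDimensional ℝ W] {V : Type*}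
    [NormedAddCommGroup V] [NormedSpace ℝ V] {A : W →L[ℝ] V} {d : ℕ}
    (hA : Module.finrank ℝ A.range < d) {f : W → X} {E : Set W} {p : W} (C : ℝ≥0)
    (hf : ∀ ε > 0, ∀ᶠ r : ℝ in 𝓝[>] 0, ∀ q ∈ E ∩ Metric.closedBall p r,
      ∀ q' ∈ E ∩ Metric.closedBall p r,
        edist (f q) (f q') ≤ ENNReal.ofReal (C * (‖A (q' - q)‖ + ε * r))) :
    HasZeroContentDensityAt d f E p := by
  obtain ⟨M, c, hM⟩ := exists_clm_pi_finrank_range A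
  set K : ℝ := C * (c + 1)
  set D : ℝ := K * (‖M‖ + 2)
  have hD : 0 ≤ D := by positivity
  intro ε hε
  obtain ⟨m, hm⟩ := exists_nat_gt (max D (3 ^ Module.finrank ℝ A.range * D ^ d / ε))
  have hDm : D < m := (le_max_left _ _).trans_lt hm
  have hm0 : 0 < m := by exact_mod_cast hD.trans_lt hDm
  have hεm : 3 ^ Module.finrank ℝ A.range * D ^ d ≤ ε * m :=
    (div_le_iff₀' (by exact_mod_cast hε)).1 ((le_max_right _ _).trans hm.le)
  filter_upwards [hf (1 / m) (by positivity), self_mem_nhdsWithin] with r hr hr0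
  have hr0 : 0 < r := hr0
  have hdist : ∀ q ∈ E ∩ Metric.closedBall p r, ∀ q' ∈ E ∩ Metric.closedBall p r,
      edist (f q) (f q') ≤ ENNReal.ofReal (K * (‖M (q' - q)‖ + r / m)) := by
    refine fun q hq q' hq' => (hr q hq q' hq').trans (ENNReal.ofReal_le_ofReal ?_)
    rw [one_div_mul_eq_div, mul_assoc]
    have hcross : 0 ≤ ‖M (q' - q)‖ + c * (r / m) := by positivity
    gcongr
    linarith [hM (q' - q)]
  refine (hausdorffContent_image_le_of_edist_le M hr0 inter_subset_right hm0 (by positivity) hdist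
    hDm.le d).trans ?_
  have hreal := ENNReal.ofReal_le_ofReal (three_mul_pow_le_of_lt hA hm0 hD hr0.le hεm)
  rw [ENNReal.ofReal_mul ε.coe_nonneg, ENNReal.ofReal_coe_nnreal,
    ENNReal.ofReal_mul (by positivity), ENNReal.ofReal_pow (by positivity)] at hreal
  refine le_trans (le_of_eq ?_) hreal
  have hcast : ENNReal.ofReal (2 * m + 1) = (2 * m + 1 : ℕ) := by
    rw [← ENNReal.ofReal_natCast]
    push_cast
    rfl
  rw [ENNReal.ofReal_pow (by positivity), hcast]

end LowRank

theorem ae_asymptoticallyDenseAt {W : Type*} [NormedAddCommGroup W] [NormedSpace ℝ W]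
    [FiniteDimensional ℝ W] [MeasurableSpace W] [BorelSpace W] (μ : Measure W)
    [μ.IsAddHaarMeasure] (E : Set W) : ∀ᵐ p ∂μ, p ∈ E → AsymptoticallyDenseAt E p := by
  refine ae_imp_of_ae_restrict ?_
  filter_upwards [ae_all_iff.2 fun n : ℕ =>
    IsUnifLocDoublingMeasure.ae_tendsto_measure_inter_div.{_, 0} μ E (n : ℝ)] with p hp δ hδ
  obtain ⟨n, hn⟩ := exists_nat_ge (1 / δ)
  rw [div_le_iff₀ hδ] at hn
  -- the density theorem allows the centre of the small ball to depend on the scale: take a bad one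
  have hcentre : ∀ r : ℝ, ∃ w, 0 < r → w ∈ Metric.closedBall p r ∧
      ((∃ q ∈ E, dist q w ≤ δ * r) → ∀ w' ∈ Metric.closedBall p r, ∃ q ∈ E, dist q w' ≤ δ * r) := by
    intro r
    by_cases h : ∀ w' ∈ Metric.closedBall p r, ∃ q ∈ E, dist q w' ≤ δ * r
    · exact ⟨p, fun hr => ⟨Metric.mem_closedBall_self hr.le, fun _ => h⟩⟩
    · obtain ⟨w, hw, hbad⟩ := by simpa only [not_forall] using h
      exact ⟨w, fun _ => ⟨hw, fun hgood => absurd hgood hbad⟩⟩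
  choose w hw using hcentre
  have hscale : Tendsto (fun r : ℝ => δ * r) (𝓝[>] 0) (𝓝[>] 0) :=
    fun s hs => eventually_nhdsGT_zero_mul_left hδ hs
  have hdensity := hp n w (fun r => δ * r) hscale <| by
    filter_upwards [self_mem_nhdsWithin] with r hr
    rw [Metric.mem_closedBall, dist_comm, ← mul_assoc]
    exact (hw r hr).1.trans (le_mul_of_one_le_left (le_of_lt hr) hn)
  filter_upwards [hdensity.eventually (lt_mem_nhds zero_lt_one), self_mem_nhdsWithin] with r hr hr0
  refine (hw r hr0).2 (by_contra fun hempty => ?_)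
  have hdisj : E ∩ Metric.closedBall (w r) (δ * r) = ∅ :=
    eq_empty_of_forall_notMem fun q hq => hempty ⟨q, hq⟩
  simp [hdisj] at hr
/-! ### The Korányi norm -/

namespace Heisenberg

variable {n : ℕ}

/-- The horizontal coordinates `(x, y) ∈ ℝ^n × ℝ^n` of a point `(x, y, t)`. -/
def horizontalPart (p : Heisenberg n) : (Fin n → ℝ) × (Fin n → ℝ) := (p.x, p.y)

/-- The symplectic form on `ℝ^n × ℝ^n` with the factor `2` it carries in the group law, so that
`(p * q).t = p.t + q.t + symplecticForm n (horizontalPart p) (horizontalPart q)`. -/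
noncomputable def symplecticForm (n : ℕ) :
    ((Fin n → ℝ) × (Fin n → ℝ)) →L[ℝ] ((Fin n → ℝ) × (Fin n → ℝ)) →L[ℝ] ℝ :=
  let x (i : Fin n) : ((Fin n → ℝ) × (Fin n → ℝ)) →L[ℝ] ℝ :=
    (ContinuousLinearMap.proj i).comp (ContinuousLinearMap.fst ℝ _ _)
  let y (i : Fin n) : ((Fin n → ℝ) × (Fin n → ℝ)) →L[ℝ] ℝ :=
    (ContinuousLinearMap.proj i).comp (ContinuousLinearMap.snd ℝ _ _)
  (2 : ℝ) • ∑ i, ((y i).smulRight (x i) - (x i).smulRight (y i))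

theorem symplecticForm_apply (v w : (Fin n → ℝ) × (Fin n → ℝ)) :
    symplecticForm n v w = 2 * ∑ i, (v.2 i * w.1 i - v.1 i * w.2 i) := by
  simp [symplecticForm]

theorem symplecticForm_self (v : (Fin n → ℝ) × (Fin n → ℝ)) : symplecticForm n v v = 0 := by
  simp [symplecticForm_apply, mul_comm]

theorem ker_symplecticForm (n : ℕ) : (symplecticForm n).ker = ⊥ := by
  refine (Submodule.eq_bot_iff _).2 fun v hv => ?_
  have hv : ∀ w, symplecticForm n v w = 0 := fun w => by
    rw [show symplecticForm n v = 0 from hv, zero_apply]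
  ext i
  · simpa [symplecticForm_apply, Pi.single_apply] using hv (0, Pi.single i 1)
  · simpa [symplecticForm_apply, Pi.single_apply] using hv (Pi.single i 1, 0)

theorem finrank_le_of_isotropic {S : Submodule ℝ ((Fin n → ℝ) × (Fin n → ℝ))}
    (hS : ∀ v ∈ S, ∀ w ∈ S, symplecticForm n v w = 0) : Module.finrank ℝ S ≤ n := by
  let B : LinearMap.BilinForm ℝ ((Fin n → ℝ) × (Fin n → ℝ)) :=
    (ContinuousLinearMap.coeLM ℝ).comp (symplecticForm n).toLinearMap
  have hker : LinearMap.ker B = ⊥ := by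
    rw [LinearMap.ker_comp_of_ker_eq_bot _
      (LinearMap.ker_eq_bot.2 ContinuousLinearMap.coe_injective)]
    exact ker_symplecticForm n
  have hle : S ≤ B.orthogonal S := fun w hw v hv => hS v hv w hw
  have hsum := LinearMap.BilinForm.finrank_add_finrank_orthogonal' (B := B) S
  have htotal : Module.finrank ℝ ((Fin n → ℝ) × (Fin n → ℝ)) = n + n := by simp
  rw [hker, inf_bot_eq, finrank_bot, add_zero, htotal] at hsum
  linarith [Submodule.finrank_mono hle]

theorem horizontalPart_inv_mul (p q : Heisenberg n) :
    horizontalPart (p⁻¹ * q) = horizontalPart q - horizontalPart p := by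
  ext i <;> simp [horizontalPart, neg_add_eq_sub]

theorem inv_mul_t (p q : Heisenberg n) :
    (p⁻¹ * q).t = q.t - p.t - symplecticForm n (horizontalPart p) (horizontalPart q) := by
  have hneg : ∑ i, (p⁻¹.y i * q.x i - p⁻¹.x i * q.y i)
      = -∑ i, (p.y i * q.x i - p.x i * q.y i) := by
    rw [← Finset.sum_neg_distrib]
    refine Finset.sum_congr rfl fun i _ => ?_
    simp only [inv_x, inv_y, Pi.neg_apply]
    ring
  rw [mul_t, hneg, inv_t, symplecticForm_apply, horizontalPart, horizontalPart]
  ring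

theorem koranyiNorm_nonneg (p : Heisenberg n) : 0 ≤ koranyiNorm p := by
  rw [koranyiNorm]
  positivity

theorem koranyiNorm_pow_four (p : Heisenberg n) :
    koranyiNorm p ^ 4 = (∑ i, (p.x i ^ 2 + p.y i ^ 2)) ^ 2 + p.t ^ 2 := by
  rw [koranyiNorm, one_div]
  exact_mod_cast Real.rpow_inv_natCast_pow (by positivity) four_ne_zero

theorem sqrt_sum_le_koranyiNorm (p : Heisenberg n) :
    √(∑ i, (p.x i ^ 2 + p.y i ^ 2)) ≤ koranyiNorm p := by
  refine Real.sqrt_le_iff.2 ⟨koranyiNorm_nonneg p, ?_⟩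
  refine (abs_le_of_sq_le_sq' ?_ (sq_nonneg _)).2
  rw [← pow_mul, koranyiNorm_pow_four]
  exact le_add_of_nonneg_right (sq_nonneg _)

theorem abs_t_le_koranyiNorm_sq (p : Heisenberg n) : |p.t| ≤ koranyiNorm p ^ 2 := by
  refine abs_le_of_sq_le_sq ?_ (sq_nonneg _)
  rw [← pow_mul, koranyiNorm_pow_four]
  exact le_add_of_nonneg_left (sq_nonneg _)

theorem norm_horizontalPart_le_koranyiNorm (p : Heisenberg n) :
    ‖horizontalPart p‖ ≤ koranyiNorm p := by
  refine norm_prod_le_iff.2 ⟨?_, ?_⟩ <;>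
    refine (pi_norm_le_iff_of_nonneg (koranyiNorm_nonneg p)).2 fun i => ?_
  · exact (abs_le_sqrt_sum p.x p.y i).1.trans (sqrt_sum_le_koranyiNorm p)
  · exact (abs_le_sqrt_sum p.x p.y i).2.trans (sqrt_sum_le_koranyiNorm p)

theorem koranyiNorm_le {p : Heisenberg n} {a : ℝ} (ha : ‖horizontalPart p‖ ≤ a)
    (ht : |p.t| ≤ a ^ 2) : koranyiNorm p ≤ (2 * n + 1) * a := by
  have ha0 : 0 ≤ a := (norm_nonneg _).trans ha
  obtain ⟨hx, hy⟩ := norm_prod_le_iff.1 ha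
  have hsum : ∑ i, (p.x i ^ 2 + p.y i ^ 2) ≤ 2 * n * a ^ 2 := by
    calc ∑ i, (p.x i ^ 2 + p.y i ^ 2) ≤ ∑ _i : Fin n, (a ^ 2 + a ^ 2) :=
          Finset.sum_le_sum fun i _ => add_le_add
            (sq_le_sq' (abs_le.1 ((norm_le_pi_norm _ i).trans hx)).1
              (abs_le.1 ((norm_le_pi_norm _ i).trans hx)).2)
            (sq_le_sq' (abs_le.1 ((norm_le_pi_norm _ i).trans hy)).1
              (abs_le.1 ((norm_le_pi_norm _ i).trans hy)).2)
      _ = 2 * n * a ^ 2 := by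
          rw [Finset.sum_const, Finset.card_univ, Fintype.card_fin, nsmul_eq_mul]
          ring
  refine le_of_pow_le_pow_left₀ four_ne_zero (by positivity) ?_
  calc koranyiNorm p ^ 4 = (∑ i, (p.x i ^ 2 + p.y i ^ 2)) ^ 2 + |p.t| ^ 2 := by
        rw [koranyiNorm_pow_four, sq_abs]
    _ ≤ (2 * n * a ^ 2) ^ 2 + (a ^ 2) ^ 2 := by gcongr
    _ = (4 * n ^ 2 + 1) * a ^ 4 := by ring
    _ ≤ (2 * n + 1) ^ 4 * a ^ 4 := by
        gcongr
        have hn : (0 : ℝ) ≤ n := n.cast_nonneg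
        nlinarith [pow_nonneg hn 4, pow_nonneg hn 3, pow_nonneg hn 2]
    _ = ((2 * n + 1) * a) ^ 4 := by ring

/-! ### The distance to the identity for the Carnot–Carathéodory metric -/

theorem ac_sum {ι : Type*} {s : Finset ι} {f : ι → ℝ → ℝ} {a b : ℝ}
    (hf : ∀ i ∈ s, AbsolutelyContinuousOnInterval (f i) a b) :
    AbsolutelyContinuousOnInterval (fun r => ∑ i ∈ s, f i r) a b := by
  rw [← Finset.sum_fn]
  exact Finset.sum_induction f (AbsolutelyContinuousOnInterval · a b) (fun _ _ hg hh => hg.add hh)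
    (LipschitzWith.const (0 : ℝ)).lipschitzOnWith.absolutelyContinuousOnInterval hf

theorem IsHorizontalCurve.mul_left {γ : ℝ → Heisenberg n} {u v : ℝ → Fin n → ℝ} {a b : ℝ}
    (h : IsHorizontalCurve γ u v a b) (g : Heisenberg n) :
    IsHorizontalCurve (fun s => g * γ s) u v a b where
  le := h.le
  ac_x i := (LipschitzWith.const (g.x i)).lipschitzOnWith.absolutelyContinuousOnInterval.add
    (h.ac_x i)
  ac_y i := (LipschitzWith.const (g.y i)).lipschitzOnWith.absolutelyContinuousOnInterval.add
    (h.ac_y i)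
  ac_t := ((LipschitzWith.const g.t).lipschitzOnWith.absolutelyContinuousOnInterval.add h.ac_t).add
    ((ac_sum fun i _ => ((h.ac_x i).const_mul (g.y i)).sub ((h.ac_y i).const_mul (g.x i))).const_mul
      2)
  measurable_u := h.measurable_u
  measurable_v := h.measurable_v
  deriv_x := by filter_upwards [h.deriv_x] with s hx hs i using (hx hs i).const_add (g.x i)
  deriv_y := by filter_upwards [h.deriv_y] with s hy hs i using (hy hs i).const_add (g.y i)
  deriv_t := by
    filter_upwards [h.deriv_x, h.deriv_y, h.deriv_t] with s hx hy ht hs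
    have hsum := HasDerivAt.fun_sum fun i (_ : i ∈ Finset.univ) =>
      ((hx hs i).const_mul (g.y i)).sub ((hy hs i).const_mul (g.x i))
    refine (((ht hs).const_add g.t).add (hsum.const_mul 2)).congr_deriv ?_
    rw [Finset.mul_sum, ← Finset.sum_add_distrib]
    refine Finset.sum_congr rfl fun i _ => ?_
    simp only [mul_x, mul_y, Pi.add_apply]
    ring

theorem ccDist_mul_left_le (g p q : Heisenberg n) : ccDist (g * p) (g * q) ≤ ccDist p q := by
  refine le_sInf ?_
  rintro _ ⟨γ, u, v, a, b, h, rfl, rfl, rfl⟩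
  exact ccDist_le (h.mul_left g)

/-- The Carnot–Carathéodory distance to the identity. -/
noncomputable def ccNorm (g : Heisenberg n) : ℝ≥0∞ := ccDist 1 g

theorem ccDist_eq_ccNorm (p q : Heisenberg n) : ccDist p q = ccNorm (p⁻¹ * q) := by
  refine le_antisymm ?_ ?_
  · simpa [ccNorm] using ccDist_mul_left_le p 1 (p⁻¹ * q)
  · simpa [ccNorm] using ccDist_mul_left_le p⁻¹ p q

theorem ccNorm_mul_le (g h : Heisenberg n) : ccNorm (g * h) ≤ ccNorm g + ccNorm h := by
  simpa [ccDist_eq_ccNorm] using ccDist_triangle 1 g (g * h)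

theorem ccNorm_inv_le (g : Heisenberg n) : ccNorm g⁻¹ ≤ ccNorm g := by
  simpa [ccDist_eq_ccNorm] using ccDist_comm_le 1 g

theorem ccNorm_commutator_le (g h : Heisenberg n) :
    ccNorm (g * h * g⁻¹ * h⁻¹) ≤ 2 * (ccNorm g + ccNorm h) := by
  calc ccNorm (g * h * g⁻¹ * h⁻¹) ≤ ccNorm g + ccNorm h + ccNorm g⁻¹ + ccNorm h⁻¹ :=
        (ccNorm_mul_le _ _).trans (add_le_add_left ((ccNorm_mul_le _ _).trans
          (add_le_add_left (ccNorm_mul_le _ _) _)) _)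
    _ ≤ ccNorm g + ccNorm h + ccNorm g + ccNorm h := by
        gcongr <;> exact ccNorm_inv_le _
    _ = 2 * (ccNorm g + ccNorm h) := by ring

theorem ccNorm_horizontal_le (u v : Fin n → ℝ) :
    ccNorm (⟨u, v, 0⟩ : Heisenberg n) ≤ ENNReal.ofReal √(∑ i, (u i ^ 2 + v i ^ 2)) := by
  have h := ccDist_le (isHorizontalCurve_line 1 u v)
  have h0 : (1 : Heisenberg n) = ⟨0, 0, 0⟩ := rfl
  simpa [horizontalLength, ← h0, ccNorm] using h

theorem commutator_horizontal (u v : Fin n → ℝ) :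
    (⟨0, v, 0⟩ * ⟨u, 0, 0⟩ * ⟨0, v, 0⟩⁻¹ * ⟨u, 0, 0⟩⁻¹ : Heisenberg n)
      = ⟨0, 0, 4 * ∑ i, v i * u i⟩ := by
  ext i
  · simp
  · simp
  · simp only [mul_x, mul_y, mul_t, inv_x, inv_y, inv_t, Pi.add_apply, Pi.neg_apply, Pi.zero_apply,
      add_zero, zero_add, neg_zero, mul_zero, zero_mul, sub_zero, sub_self, mul_neg,
      sub_neg_eq_add, add_neg_cancel, Finset.sum_const_zero]
    rw [Finset.sum_congr rfl fun i _ => mul_comm (u i) (v i)]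
    ring

theorem ccNorm_vertical_le (hn : 0 < n) (t : ℝ) :
    ccNorm (⟨0, 0, t⟩ : Heisenberg n) ≤ 2 * ENNReal.ofReal √|t| := by
  let e (c : ℝ) : Fin n → ℝ := Pi.single ⟨0, hn⟩ c
  have hsum (c : ℝ) : ∑ i, e c i ^ 2 = c ^ 2 := by
    simp [e, Pi.single_apply]
  set α : ℝ := √|t| / 2
  set β : ℝ := t / √|t| / 2
  have hα : √(α ^ 2) = √|t| / 2 := Real.sqrt_sq (by positivity)
  have hβ : √(β ^ 2) = √|t| / 2 := by
    rw [Real.sqrt_sq_eq_abs, abs_div, abs_div, abs_two, abs_of_nonneg (Real.sqrt_nonneg _),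
      Real.div_sqrt]
  have hαβ : 4 * ∑ i, e α i * e β i = t := by
    rcases eq_or_ne t 0 with rfl | ht
    · simp [α, e]
    · have : √|t| ≠ 0 := by positivity
      simp only [α, β, e, Pi.single_apply, mul_ite, ite_mul, zero_mul, mul_zero, Finset.sum_ite_eq',
        Finset.mem_univ, ↓reduceIte]
      field_simp
      norm_num
  calc ccNorm (⟨0, 0, t⟩ : Heisenberg n)
      = ccNorm (⟨0, e α, 0⟩ * ⟨e β, 0, 0⟩ * ⟨0, e α, 0⟩⁻¹ * ⟨e β, 0, 0⟩⁻¹ : Heisenberg n) := by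
        rw [commutator_horizontal, hαβ]
    _ ≤ 2 * (ENNReal.ofReal √(α ^ 2) + ENNReal.ofReal √(β ^ 2)) := by
        refine (ccNorm_commutator_le _ _).trans ?_
        gcongr
        · simpa [hsum] using ccNorm_horizontal_le 0 (e α)
        · simpa [hsum] using ccNorm_horizontal_le (e β) 0
    _ = 2 * ENNReal.ofReal √|t| := by
        rw [hα, hβ, ← ENNReal.ofReal_add (by positivity) (by positivity), add_halves]

theorem ccNorm_le_koranyiNorm (hn : 0 < n) (g : Heisenberg n) :
    ccNorm g ≤ 3 * ENNReal.ofReal (koranyiNorm g) := by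
  have hsplit : (⟨g.x, g.y, 0⟩ * ⟨0, 0, g.t⟩ : Heisenberg n) = g := by
    ext i <;> simp
  have hvertical : √|g.t| ≤ koranyiNorm g :=
    Real.sqrt_le_iff.2 ⟨koranyiNorm_nonneg g, abs_t_le_koranyiNorm_sq g⟩
  calc ccNorm g = ccNorm (⟨g.x, g.y, 0⟩ * ⟨0, 0, g.t⟩ : Heisenberg n) := by rw [hsplit]
    _ ≤ ENNReal.ofReal √(∑ i, (g.x i ^ 2 + g.y i ^ 2)) + 2 * ENNReal.ofReal √|g.t| :=
      (ccNorm_mul_le _ _).trans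
        (add_le_add (ccNorm_horizontal_le g.x g.y) (ccNorm_vertical_le hn g.t))
    _ ≤ ENNReal.ofReal (koranyiNorm g) + 2 * ENNReal.ofReal (koranyiNorm g) := by
      gcongr
      exact sqrt_sum_le_koranyiNorm g
    _ = 3 * ENNReal.ofReal (koranyiNorm g) := by ring

theorem abs_sum_horizontal_le {p : Heisenberg n} {M : ℝ} (hp : ‖horizontalPart p‖ ≤ M)
    (u v : Fin n → ℝ) :
    |∑ i, (u i * (2 * p.y i) + v i * (-(2 * p.x i)))|
      ≤ 4 * n * M * √(∑ i, (u i ^ 2 + v i ^ 2)) := by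
  obtain ⟨hx, hy⟩ := norm_prod_le_iff.1 hp
  set ρ := √(∑ i, (u i ^ 2 + v i ^ 2))
  have hterm (i : Fin n) : |u i * (2 * p.y i) + v i * (-(2 * p.x i))| ≤ 4 * M * ρ := by
    obtain ⟨hu, hv⟩ := abs_le_sqrt_sum u v i
    calc |u i * (2 * p.y i) + v i * (-(2 * p.x i))|
        ≤ |u i| * (2 * |p.y i|) + |v i| * (2 * |p.x i|) := by
          refine (abs_add_le _ _).trans_eq ?_
          rw [abs_mul (u i), abs_mul (v i), abs_neg, abs_mul, abs_mul, abs_two]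
      _ ≤ ρ * (2 * M) + ρ * (2 * M) := by
          gcongr
          · exact (norm_le_pi_norm p.y i).trans hy
          · exact (norm_le_pi_norm p.x i).trans hx
      _ = 4 * M * ρ := by ring
  calc |∑ i, (u i * (2 * p.y i) + v i * (-(2 * p.x i)))| ≤ ∑ _i : Fin n, 4 * M * ρ :=
        (Finset.abs_sum_le_sum_abs _ _).trans (Finset.sum_le_sum fun i _ => hterm i)
    _ = 4 * n * M * ρ := by
        rw [Finset.sum_const, Finset.card_univ, Fintype.card_fin, nsmul_eq_mul]
        ring

theorem IsHorizontalCurve.norm_horizontalPart_le {γ : ℝ → Heisenberg n} {u v : ℝ → Fin n → ℝ}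
    {a b : ℝ} (h : IsHorizontalCurve γ u v a b) (ha : γ a = 1) {ℓ : ℝ≥0}
    (hℓ : horizontalLength u v a b = ℓ) {s : ℝ} (hs : s ∈ Icc a b) :
    ‖horizontalPart (γ s)‖ ≤ ℓ := by
  have hxy (i : Fin n) : ‖(γ s).x i‖₊ ≤ ℓ ∧ ‖(γ s).y i‖₊ ≤ ℓ := by
    simpa only [ha, hℓ, one_x, one_y, Pi.zero_apply, edist_zero_right, enorm_le_coe] using
      h.edist_xy_le hs i
  exact norm_prod_le_iff.2 ⟨(pi_norm_le_iff_of_nonneg ℓ.coe_nonneg).2 fun i => (hxy i).1,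
    (pi_norm_le_iff_of_nonneg ℓ.coe_nonneg).2 fun i => (hxy i).2⟩

theorem IsHorizontalCurve.abs_t_le {γ : ℝ → Heisenberg n} {u v : ℝ → Fin n → ℝ} {a b : ℝ}
    (h : IsHorizontalCurve γ u v a b) (ha : γ a = 1) {ℓ : ℝ≥0}
    (hℓ : horizontalLength u v a b = ℓ) : |(γ b).t| ≤ 4 * n * ℓ ^ 2 := by
  have ht : edist (γ b).t (γ a).t ≤ ((4 * n * ℓ : ℝ≥0) : ℝ≥0∞) * horizontalLength u v a b :=
    edist_le_of_ac (4 * n * ℓ) h.le h.ac_t h.deriv_t fun s hs => by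
      simpa using abs_sum_horizontal_le (h.norm_horizontalPart_le ha hℓ hs) (u s) (v s)
  rw [hℓ, ha, one_t, ← ENNReal.coe_mul, edist_le_coe, ← NNReal.coe_le_coe, coe_nndist,
    dist_zero_right, Real.norm_eq_abs] at ht
  refine ht.trans_eq ?_
  push_cast
  ring

theorem IsHorizontalCurve.koranyiNorm_le {γ : ℝ → Heisenberg n} {u v : ℝ → Fin n → ℝ} {a b : ℝ}
    (h : IsHorizontalCurve γ u v a b) (ha : γ a = 1) :
    ENNReal.ofReal (koranyiNorm (γ b))
      ≤ (((2 * n + 1) ^ 2 : ℝ≥0) : ℝ≥0∞) * horizontalLength u v a b := by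
  rcases eq_or_ne (horizontalLength u v a b) ⊤ with htop | hfin
  · rw [htop, ENNReal.mul_top (by positivity)]
    exact le_top
  lift horizontalLength u v a b to ℝ≥0 using hfin with ℓ hℓ
  have hℓ0 : (0 : ℝ) ≤ ℓ := ℓ.coe_nonneg
  have hn : (0 : ℝ) ≤ n := n.cast_nonneg
  have hnorm : koranyiNorm (γ b) ≤ (2 * n + 1) * ((2 * n + 1) * ℓ) := by
    refine Heisenberg.koranyiNorm_le ?_ ?_
    · refine (h.norm_horizontalPart_le ha hℓ.symm ⟨h.le, le_rfl⟩).trans ?_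
      exact le_mul_of_one_le_left hℓ0 (by linarith)
    · calc |(γ b).t| ≤ 4 * n * ℓ ^ 2 := h.abs_t_le ha hℓ.symm
        _ ≤ ((2 * n + 1) * ℓ) ^ 2 := by
          rw [mul_pow]
          gcongr
          nlinarith [hn]
  rw [← ENNReal.coe_mul]
  refine ENNReal.ofReal_le_of_le_toReal (hnorm.trans_eq ?_)
  rw [ENNReal.coe_toReal]
  push_cast
  ring

theorem koranyiNorm_le_ccNorm (g : Heisenberg n) :
    ENNReal.ofReal (koranyiNorm g) ≤ (((2 * n + 1) ^ 2 : ℝ≥0) : ℝ≥0∞) * ccNorm g := by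
  have hC : (((2 * n + 1) ^ 2 : ℝ≥0) : ℝ≥0∞) ≠ 0 :=
    ENNReal.coe_ne_zero.2 (by positivity)
  rw [ccNorm, ← ENNReal.div_le_iff' hC ENNReal.coe_ne_top]
  refine le_sInf ?_
  rintro _ ⟨γ, u, v, a, b, h, ha, rfl, rfl⟩
  rw [ENNReal.div_le_iff' hC ENNReal.coe_ne_top]
  exact h.koranyiNorm_le ha

/-! ### Lipschitz maps into the Heisenberg group -/

theorem Koranyi.dist_eq (p q : Koranyi n) : dist p q = koranyiNorm (p.pt⁻¹ * q.pt) :=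
  dist_comm p q

theorem contactDefect_eq {W : Type*} (f : W → Koranyi n) (q q' : W) :
    contactDefect (symplecticForm n) (fun r => horizontalPart (f r).pt) (fun r => (f r).pt.t) q q'
      = ((f q).pt⁻¹ * (f q').pt).t :=
  (inv_mul_t _ _).symm

theorem lipschitzOnWith_horizontalPart {W : Type*} [PseudoMetricSpace W] {f : W → Koranyi n}
    {E : Set W} {L : ℝ≥0} (hf : LipschitzOnWith L f E) :
    LipschitzOnWith L (fun q => horizontalPart (f q).pt) E :=
  LipschitzOnWith.of_dist_le_mul fun q hq q' hq' => by
    refine le_trans ?_ (hf.dist_le_mul q hq q' hq')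
    rw [dist_comm, dist_eq_norm, ← horizontalPart_inv_mul, Koranyi.dist_eq]
    exact norm_horizontalPart_le_koranyiNorm _

theorem abs_contactDefect_le {W : Type*} [PseudoMetricSpace W] {f : W → Koranyi n} {E : Set W}
    {L : ℝ≥0} (hf : LipschitzOnWith L f E) {q q' : W} (hq : q ∈ E) (hq' : q' ∈ E) :
    |contactDefect (symplecticForm n) (fun r => horizontalPart (f r).pt) (fun r => (f r).pt.t) q q'|
      ≤ (L ^ 2 : ℝ≥0) * dist q q' ^ 2 := by
  calc _ = |((f q).pt⁻¹ * (f q').pt).t| := by rw [contactDefect_eq]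
    _ ≤ dist (f q) (f q') ^ 2 := Koranyi.dist_eq (f q) (f q') ▸ abs_t_le_koranyiNorm_sq _
    _ ≤ (L * dist q q') ^ 2 := by
      gcongr
      exact hf.dist_le_mul q hq q' hq'
    _ = (L ^ 2 : ℝ≥0) * dist q q' ^ 2 := by rw [mul_pow, NNReal.coe_pow]

variable {W : Type*} [NormedAddCommGroup W] [NormedSpace ℝ W] [FiniteDimensional ℝ W]

theorem hasZeroContentDensityAt {f : W → Koranyi n} {E : Set W} {p : W} {d : ℕ} {L : ℝ≥0}
    (hd : n < d) (hf : LipschitzOnWith L f E) (hp : p ∈ E) (hE : AsymptoticallyDenseAt E p)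
    {A : W →L[ℝ] (Fin n → ℝ) × (Fin n → ℝ)}
    (hA : HasFDerivWithinAt (fun q => horizontalPart (f q).pt) A E p) :
    HasZeroContentDensityAt d f E p := by
  have hτ : ∀ q ∈ E, ∀ q' ∈ E, |contactDefect (symplecticForm n) (fun r => horizontalPart (f r).pt)
      (fun r => (f r).pt.t) q q'| ≤ (L ^ 2 : ℝ≥0) * dist q q' ^ 2 :=
    fun _ hq _ hq' => abs_contactDefect_le hf hq hq'
  have hrank : Module.finrank ℝ A.range < d := by
    refine (finrank_le_of_isotropic ?_).trans_lt hd
    rintro _ ⟨v, rfl⟩ _ ⟨w, rfl⟩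
    exact bilin_fderivWithin_eq_zero symplecticForm_self hτ hp hE hA v w
  refine hasZeroContentDensityAt_of_finrank_range_lt hrank (2 * n + 1) fun ε hε => ?_
  filter_upwards [eventually_norm_sub_le_and_abs_contactDefect_le symplecticForm_self hτ hE hA hε,
    self_mem_nhdsWithin] with r hr (hr0 : 0 < r) q hq q' hq'
  obtain ⟨hhorizontal, hdefect⟩ := hr q hq q' hq'
  rw [edist_dist, Koranyi.dist_eq]
  refine ENNReal.ofReal_le_ofReal ?_
  push_cast
  refine koranyiNorm_le (by rwa [horizontalPart_inv_mul]) ?_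
  rw [← contactDefect_eq]
  refine hdefect.trans ?_
  gcongr
  exact le_add_of_nonneg_left (norm_nonneg _)

theorem Koranyi.hausdorffMeasure_image_eq_zero
    (hn : n < Module.finrank ℝ W) {E : Set W} {f : W → Koranyi n} {L : ℝ≥0}
    (hf : LipschitzOnWith L f E) :
    Measure.hausdorffMeasure (Module.finrank ℝ W : ℝ) (f '' E) = 0 := by
  borelize W
  let μ : Measure W := Measure.hausdorffMeasure (Module.finrank ℝ W : ℝ)
  refine _root_.hausdorffMeasure_image_eq_zero μ (fun N hN hN0 => ?_) ?_
  · have hle := (hf.mono hN).hausdorffMeasure_image_le (Nat.cast_nonneg (Module.finrank ℝ W))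
    rw [show Measure.hausdorffMeasure (Module.finrank ℝ W : ℝ) N = 0 from hN0, mul_zero] at hle
    exact le_antisymm hle zero_le
  · filter_upwards [ae_asymptoticallyDenseAt μ E,
      (lipschitzOnWith_horizontalPart hf).ae_differentiableWithinAt_of_mem (μ := μ)]
      with p hdense hdiff hp
    exact hasZeroContentDensityAt hn hf hp (hdense hp) (hdiff hp).hasFDerivWithinAt

theorem lipschitzWith_ccToKoranyi :
    LipschitzWith ((2 * n + 1) ^ 2) fun p : CC n => (⟨p.pt⟩ : Koranyi n) := fun p q => by
  rw [edist_dist, Koranyi.dist_eq]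
  exact (koranyiNorm_le_ccNorm _).trans_eq (by rw [← ccDist_eq_ccNorm]; rfl)

theorem lipschitzWith_koranyiToCC (hn : 0 < n) :
    LipschitzWith 3 fun p : Koranyi n => (⟨p.pt⟩ : CC n) := fun p q => by
  rw [edist_dist p, Koranyi.dist_eq]
  exact (ccDist_eq_ccNorm _ _).trans_le (ccNorm_le_koranyiNorm hn _)

theorem CC.hausdorffMeasure_image_eq_zero (hn0 : 0 < n)
    (hn : n < Module.finrank ℝ W) {E : Set W} {f : W → CC n} {L : ℝ≥0}
    (hf : LipschitzOnWith L f E) :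
    Measure.hausdorffMeasure (Module.finrank ℝ W : ℝ) (f '' E) = 0 := by
  have hkoranyi : Measure.hausdorffMeasure (Module.finrank ℝ W : ℝ)
      ((fun q => (⟨(f q).pt⟩ : Koranyi n)) '' E) = 0 :=
    Koranyi.hausdorffMeasure_image_eq_zero hn
      (lipschitzWith_ccToKoranyi.comp_lipschitzOnWith hf)
  have hle := (lipschitzWith_koranyiToCC hn0).hausdorffMeasure_image_le
    (Nat.cast_nonneg (Module.finrank ℝ W)) ((fun q => (⟨(f q).pt⟩ : Koranyi n)) '' E)
  rw [hkoranyi, mul_zero, image_image] at hle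
  exact le_antisymm hle zero_le

end Heisenberg

theorem theorem3p2_general {n : ℕ} (hn : 0 < n) {W : Type*} [NormedAddCommGroup W]
    [NormedSpace ℝ W] [FiniteDimensional ℝ W] (hW : n < Module.finrank ℝ W) (E : Set W) :
    (∀ (f : W → Heisenberg.CC n) (L : ℝ≥0), LipschitzOnWith L f E →
        Measure.hausdorffMeasure (Module.finrank ℝ W : ℝ) (f '' E) = 0) ∧
      ∀ (f : W → Heisenberg.Koranyi n) (L : ℝ≥0), LipschitzOnWith L f E →
        Measure.hausdorffMeasure (Module.finrank ℝ W : ℝ) (f '' E) = 0 :=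
  ⟨fun _ _ hf => Heisenberg.CC.hausdorffMeasure_image_eq_zero hn hW hf,
    fun _ _ hf => Heisenberg.Koranyi.hausdorffMeasure_image_eq_zero hW hf⟩

theorem theorem3p2 (n k : ℕ) (hn : 0 < n) (hnk : n < k) :
    PurelyUnrectifiable k (Heisenberg.CC n) ∧ PurelyUnrectifiable k (Heisenberg.Koranyi n) := by
  have hk : Module.finrank ℝ (EuclideanSpace ℝ (Fin k)) = k := finrank_euclideanSpace_fin
  have h := theorem3p2_general hn (hk.symm ▸ hnk : n < Module.finrank ℝ (EuclideanSpace ℝ (Fin k)))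
  rw [hk] at h
  exact ⟨fun E f _ ⟨L, hf⟩ => (h E).1 f L hf, fun E f _ ⟨L, hf⟩ => (h E).2 f L hf⟩
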